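/- **Setting.** Let $K\ge 1$ and $D\ge 0$ be integers, $\Theta\subseteq\mathbb R^d$, and let $p_t(\theta)=p_{t+K}(\theta)\in[0,1]$ for $t\in\mathbb N$, $\theta\in\Theta$. Let $\Phi_t:\{0,1\}^{2t}\times[0,1]\to\{0,1\}$, $t\in\mathbb N$, be measurable maps (gating rules) that do not depend on $\theta$. For every $\theta\in\Theta$ let $\{(G_t,Y_t)\}_{t\ge0}$ be, under $P_\theta$, a $\{0,1\}^2$-valued dead-time event detection (DED) process, that is: * there are independent $Z_t\sim\mathrm{Ber}(p_t(\theta))$, $t\in\mathbb N$, and $U_t\sim\mathrm{Unif}([0,1])$ such that, for every $t$, $U_t$ is independent of $\big((Z_s)_{s\ge0},(G_s,Y_s)_{s<t}\big)$, and almost surely $G_t=\Phi_t(G_0,Y_0,\dots,G_{t-1},Y_{t-1},U_t)$ and $Y_t=G_tZ_t$; * almost surely, $Y_t=1$ implies $G_s=0$ for all $s\in\{t+1,\dots,t+D\}$; * there is $\gamma(\theta)\in[0,1]^K$ with $\frac1L\sum_{\ell=0}^{L-1}G_{r+\ell K}\to\gamma_r(\theta)$ in $P_\theta$-probability as $L\to\infty$,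 for $r=0,\dots,K-1$. Let $P_{\theta,t}$ be the law of $(G_s,Y_s)_{0\le s<t}$ under $P_\theta$. Define $\lambda_t(\theta)\in[0,\infty]$ by $p_t(\theta)=1-e^{-\lambda_t(\theta)}$ and put $$\mathcal I_r(\theta)=\frac{1-p_r(\theta)}{p_r(\theta)}\nabla\lambda_r(\theta)\nabla\lambda_r(\theta)^\top,\qquad \mathcal I(\theta;\alpha)=\frac1K\sum_{r=0}^{K-1}\alpha_r\,\mathcal I_r(\theta)\quad(\alpha\in[0,1]^K).$$ **Assumptions.** Let $\theta_0\in\operatorname{int}(\Theta)$ be such that 1. there are constants $0<\lambda_{\min}\le\lambda_{\max}<\infty$ with $\lambda_{\min}\le\lambda_r(\theta)\le\lambda_{\max}$ for all $r=0,\dots,K-1$ and $\theta\in\Theta$; 2. each $\lambda_r:\Theta\to\mathbb R$ extends to a $C^3$ map on an open set containing $\Theta$; 3. if $\theta\in\Theta$ and $\lambda_r(\theta)=\lambda_r(\theta_0)$ for all $r$ with $\gamma_r(\theta_0)>0$, then $\theta=\theta_0$; 4. $\Theta$ is compact; 5. $\mathcal I_0:=\mathcal I(\theta_0;\gamma(\theta_0))$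 is positive definite. **Claim.** Define the normalized score $$\Delta_t(\theta_0)=\frac1{\sqrt t}\sum_{s=0}^{t-1}G_s\,\frac{Y_s-p_s(\theta_0)}{p_s(\theta_0)}\,\nabla\lambda_s(\theta_0).$$ Then, for every bounded sequence $(h_t)$ in $\mathbb R^d$: 1. $\theta_0+h_t/\sqrt t\in\Theta$ and the laws $P_{\theta_0+h_t/\sqrt t,\,t}$ and $P_{\theta_0,t}$ are mutually absolutely continuous for all sufficiently large $t$, and the sequences $\big(P_{\theta_0+h_t/\sqrt t,\,t}\big)_t$ and $\big(P_{\theta_0,t}\big)_t$ are mutually contiguous; 2. (local asymptotic normality) $$\log\frac{dP_{\theta_0+h_t/\sqrt t,\,t}}{dP_{\theta_0,t}}=h_t^\top\Delta_t(\theta_0)-\tfrac12h_t^\top\mathcal I(\theta_0;\gamma(\theta_0))h_t+o_{P_{\theta_0,t}}(1).$$ Moreover, under $P_{\theta_0,t}$, $\Delta_t(\theta_0)\Rightarrow\mathcal N(0,\mathcal I_0)$ as $t\to\infty$. -/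

import Mathlib

open MeasureTheory ProbabilityTheory Filter Topology
open scoped ENNReal Matrix

namespace DED

/-- The parameter space `ℝ^d` with the Euclidean norm. -/
abbrev Param (d : ℕ) : Type := EuclideanSpace ℝ (Fin d)

/-- The real value (`0` or `1`) of a binary variable. -/
def bit (b : Bool) : ℝ := if b then 1 else 0

/-- The data `(G_s, Y_s)`, `s = 0, …, t - 1`, observed up to the horizon `t`. -/
def obs {Ω : Type*} (G Y : ℕ → Ω → Bool) (t : ℕ) (ω : Ω) : Fin t → Bool × Bool :=
  fun s => (G s ω, Y s ω)

/-- `(G, Y)` is, under the probability measure `μ`, a dead-time event detection process with period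
`K`, dead time `D`, event probabilities `p t`, gating rules `Φ t` and gating frequencies `γ`. -/
structure IsDEDProcess {Ω : Type*} [MeasurableSpace Ω] (μ : Measure Ω) (K D : ℕ) (p : ℕ → ℝ)
    (Φ : (t : ℕ) → (Fin t → Bool × Bool) → unitInterval → Bool) (γ : Fin K → ℝ)
    (G Y : ℕ → Ω → Bool) : Prop where
  measurable_G : ∀ t, Measurable (G t)
  measurable_Y : ∀ t, Measurable (Y t)
  /-- There are physical events `Z t`, independent Bernoulli variables with parameters `p t`, and
  randomizations `U t`, uniform on `[0, 1]`, such that `U t` is independent of the whole physical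
  event sequence together with the past observations, `G t` is a function of the past observations
  and `U t`, and `Y t = G t * Z t`. -/
  exists_latent : ∃ (Z : ℕ → Ω → Bool) (U : ℕ → Ω → unitInterval),
    (∀ t, Measurable (Z t)) ∧
    (∀ t, Measurable (U t)) ∧
    (∀ t, μ.real {ω | Z t ω = true} = p t) ∧
    iIndepFun Z μ ∧
    (∀ t, HasLaw (U t) (volume : Measure unitInterval) μ) ∧
    (∀ t, IndepFun (U t) (fun ω => ((fun s => Z s ω : ℕ → Bool), obs G Y t ω)) μ) ∧
    (∀ t, ∀ᵐ ω ∂μ, G t ω = Φ t (obs G Y t ω) (U t ω)) ∧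
    (∀ t, ∀ᵐ ω ∂μ, Y t ω = (G t ω && Z t ω))
  /-- A detection at time `t` switches the detector off at the times `t + 1, …, t + D`. -/
  dead_time : ∀ᵐ ω ∂μ, ∀ t, Y t ω = true → ∀ s, t + 1 ≤ s → s ≤ t + D → G s ω = false
  gamma_mem : ∀ r, γ r ∈ Set.Icc (0 : ℝ) 1
  /-- The empirical activation frequency of each phase `r` converges in probability to `γ r`. -/
  gating_frequency : ∀ r : Fin K,
    TendstoInMeasure μ
      (fun (L : ℕ) ω => (1 / (L : ℝ)) * ∑ l ∈ Finset.range L, bit (G ((r : ℕ) + l * K) ω))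
      atTop (fun _ => γ r)

/-- A statistical model of DED processes indexed by `θ ∈ Θ`: the event probabilities `p θ t` are
`K`-periodic in `t` and depend on the parameter `θ`, while the dead time `D` and the measurable
gating rules `Φ` (the experimenter's design) do not. Nothing but `P θ` being defined is
asked for `θ ∉ Θ`. -/
structure IsDEDModel {d : ℕ} (Θ : Set (Param d)) (K D : ℕ) (p : Param d → ℕ → ℝ)
    (Φ : (t : ℕ) → (Fin t → Bool × Bool) → unitInterval → Bool) (γ : Param d → Fin K → ℝ)
    {Ω : Param d → Type*} [∀ θ, MeasurableSpace (Ω θ)] (P : (θ : Param d) → Measure (Ω θ))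
    (G Y : (θ : Param d) → ℕ → Ω θ → Bool) : Prop where
  period_pos : 0 < K
  p_mem : ∀ θ ∈ Θ, ∀ t, p θ t ∈ Set.Icc (0 : ℝ) 1
  p_periodic : ∀ θ ∈ Θ, ∀ t, p θ (t + K) = p θ t
  measurable_gating : ∀ t, Measurable (Function.uncurry (Φ t))
  isDEDProcess : ∀ θ ∈ Θ, IsDEDProcess (P θ) K D (p θ) Φ (γ θ) (G θ) (Y θ)

/-- The finite-horizon law of the first `t` observations. -/
noncomputable def obsLaw {Ω : Type*} [MeasurableSpace Ω] (μ : Measure Ω) (G Y : ℕ → Ω → Bool)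
    (t : ℕ) : Measure (Fin t → Bool × Bool) :=
  μ.map (obs G Y t)

/-- The rate `l ∈ [0, ∞]` that solves `q = 1 - exp (-l)`, for a probability `q ∈ [0, 1]`. -/
noncomputable def eventRate (q : ℝ) : ℝ≥0∞ :=
  if q < 1 then ENNReal.ofReal (-Real.log (1 - q)) else ⊤

/-- The rate function `λ_r` as a real function of the parameter. -/
noncomputable def rate {d : ℕ} (p : Param d → ℕ → ℝ) (r : ℕ) (θ : Param d) : ℝ :=
  (eventRate (p θ r)).toReal

/-- The gradient `∇λ_r(θ)` (meaningful at interior points `θ` of the parameter set). -/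
noncomputable def gradRate {d : ℕ} (p : Param d → ℕ → ℝ) (r : ℕ) (θ : Param d) : Param d :=
  gradient (rate p r) θ

/-- The phasewise Fisher information `((1 - p_r) / p_r) ∇λ_r ∇λ_rᵀ`. -/
noncomputable def phaseInfo {d : ℕ} (p : Param d → ℕ → ℝ) (r : ℕ) (θ : Param d) :
    Matrix (Fin d) (Fin d) ℝ :=
  ((1 - p θ r) / p θ r) • Matrix.vecMulVec (gradRate p r θ).ofLp (gradRate p r θ).ofLp

/-- The information rate `(1 / K) ∑_r α_r I_r(θ)`. -/
noncomputable def infoRate {d K : ℕ} (p : Param d → ℕ → ℝ) (θ : Param d) (α : Fin K → ℝ) :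
    Matrix (Fin d) (Fin d) ℝ :=
  (1 / (K : ℝ)) • ∑ r : Fin K, α r • phaseInfo p r θ

/-- The regularity assumptions on the model at the true parameter `θ₀`. -/
structure RegularAt {d K : ℕ} (Θ : Set (Param d)) (p : Param d → ℕ → ℝ)
    (γ : Param d → Fin K → ℝ) (θ₀ : Param d) : Prop where
  mem_interior : θ₀ ∈ interior Θ
  rate_bounds : ∃ lmin lmax : ℝ, 0 < lmin ∧ lmin ≤ lmax ∧ ∀ r : Fin K, ∀ θ ∈ Θ,
    ENNReal.ofReal lmin ≤ eventRate (p θ r) ∧ eventRate (p θ r) ≤ ENNReal.ofReal lmax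
  rate_smooth : ∀ r : Fin K, ∃ (V : Set (Param d)) (g : Param d → ℝ),
    IsOpen V ∧ Θ ⊆ V ∧ ContDiffOn ℝ 3 g V ∧ ∀ θ ∈ Θ, rate p r θ = g θ
  identifiable : ∀ θ ∈ Θ,
    (∀ r : Fin K, 0 < γ θ₀ r → eventRate (p θ r) = eventRate (p θ₀ r)) → θ = θ₀
  isCompact : IsCompact Θ
  info_posDef : (infoRate p θ₀ (γ θ₀)).PosDef

/-- The normalized score `Δ_t(θ)`, a function of the first `t` observations. -/
noncomputable def score {d : ℕ} (p : Param d → ℕ → ℝ) (θ : Param d) (t : ℕ)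
    (x : Fin t → Bool × Bool) : Param d :=
  (1 / Real.sqrt t) •
    ∑ s : Fin t, (bit (x s).1 * ((bit (x s).2 - p θ s) / p θ s)) • gradRate p s θ

/-- The local parameter `θ + h / √t`. -/
noncomputable def localParam {d : ℕ} (θ h : Param d) (t : ℕ) : Param d :=
  θ + (1 / Real.sqrt t) • h

/-- The sequence of measures `Q t` is contiguous with respect to the sequence `R t`. -/
def Contiguous {α : ℕ → Type*} [∀ t, MeasurableSpace (α t)] (Q R : (t : ℕ) → Measure (α t)) :
    Prop :=
  ∀ A : (t : ℕ) → Set (α t), (∀ t, MeasurableSet (A t)) →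
    Tendsto (fun t => R t (A t)) atTop (𝓝 0) → Tendsto (fun t => Q t (A t)) atTop (𝓝 0)

/-- `X t = o_{R t}(1)`: the variables `X t` converge to `0` in probability under `R t`. -/
def IsLittleOInProb {α : ℕ → Type*} [∀ t, MeasurableSpace (α t)] (R : (t : ℕ) → Measure (α t))
    (X : (t : ℕ) → α t → ℝ) : Prop :=
  ∀ ε : ℝ, 0 < ε → Tendsto (fun t => R t {x | ε ≤ |X t x|}) atTop (𝓝 0)

end DED

namespace DED

/-! The gating rules do not depend on `θ`. By independence of the randomizations and of the physical
events, the law of the first `t` observations is a `θ`-free gating factor times a product of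
Bernoulli weights (`IsDEDProcess.obsLaw_real_singleton`). Every likelihood ratio is thus a product
of one-step ratios, which differ from `1` only at active times. All computations are sums over the
finite observation space, with the tower property `sum_gateWeight_succ` in place of martingale
theory.

Local expansion. With `c = ⟨∇λ_s, h_t⟩`, the event probability moves by `(1 - p_s) c / √t +
o(1/√t)`. Each log ratio is its score term, plus a gated mean, plus a conditionally centred
remainder of conditional variance `o(1/t)`. The remainders sum to `o(1)` in mean square. The gated
means are `-(1 - p_s) c² / (2 p_s t)` up to `o(1/t)`, so convergence of the gating frequencies turns
their sum into minus half the information form (`IsDEDProcess.isLittleOInProb_logRatio`).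

Contiguity. The one-step chi-square divergences are `O(1/t)`, so the likelihood ratio has bounded
second moment, and Cauchy-Schwarz gives `Q(A)² ≤ e^M R(A)`. The bound is symmetric in the two
parameters.

Score. Let `φ_s` be the characteristic function of one active score term and `V = ∑ G_s log φ_s`.
Then `exp(iS - V)` has mean exactly one, and `V` converges in mean to the Gaussian exponent by the
same law of large numbers (`IsDEDProcess.tendsto_integral_cexp_score`). Lévy's continuity theorem
concludes. -/

/-- The probability that the gating rule `Φ t` takes the value `g` after the past `y`. -/
noncomputable def gateProb (Φ : (t : ℕ) → (Fin t → Bool × Bool) → unitInterval → Bool) (t : ℕ)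
    (y : Fin t → Bool × Bool) (g : Bool) : ℝ :=
  (volume : Measure unitInterval).real {u | Φ t y u = g}

/-- The contribution of the gating decisions to the likelihood of the observations `x`. -/
noncomputable def gateWeight (Φ : (t : ℕ) → (Fin t → Bool × Bool) → unitInterval → Bool) :
    (t : ℕ) → (Fin t → Bool × Bool) → ℝ
  | 0, _ => 1
  | t + 1, x => gateWeight Φ t (Fin.init x) * gateProb Φ t (Fin.init x) (x (Fin.last t)).1

/-- The conditional probability of the value of `Y` in `x = (G, Y)` given that of `G`, when the
event probability is `p`. -/
def eventWeight (p : ℝ) (x : Bool × Bool) : ℝ :=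
  if x.1 then (if x.2 then p else 1 - p) else (if x.2 then 0 else 1)

/-! ### Factorization of the likelihood and moments under it. -/

section Likelihood

variable {Φ : (t : ℕ) → (Fin t → Bool × Bool) → unitInterval → Bool}

lemma gateProb_nonneg (t : ℕ) (y : Fin t → Bool × Bool) (g : Bool) : 0 ≤ gateProb Φ t y g :=
  measureReal_nonneg

lemma gateWeight_nonneg (t : ℕ) (x : Fin t → Bool × Bool) : 0 ≤ gateWeight Φ t x := by
  induction t with
  | zero => simp [gateWeight]
  | succ t ih => exact mul_nonneg (ih _) (gateProb_nonneg _ _ _)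

lemma measurable_gating_apply (hΦ : ∀ t, Measurable (Function.uncurry (Φ t))) (t : ℕ)
    (y : Fin t → Bool × Bool) : Measurable (Φ t y) :=
  (hΦ t).comp (measurable_const.prodMk measurable_id)

lemma sum_gateProb (hΦ : ∀ t, Measurable (Function.uncurry (Φ t))) (t : ℕ)
    (y : Fin t → Bool × Bool) : ∑ g, gateProb Φ t y g = 1 := by
  have h : {u | Φ t y u = false} = {u | Φ t y u = true}ᶜ := by ext; simp
  have hm : MeasurableSet {u | Φ t y u = true} :=
    measurable_gating_apply hΦ t y (measurableSet_singleton true)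
  rw [Fintype.sum_bool, gateProb, gateProb, h, probReal_compl_eq_one_sub hm]
  ring

lemma eventWeight_nonneg {p : ℝ} (hp : p ∈ Set.Icc (0 : ℝ) 1) (x : Bool × Bool) :
    0 ≤ eventWeight p x := by
  have := hp.1
  have := hp.2
  unfold eventWeight
  split_ifs <;> linarith

/-- The two sides are generated by the disjoint index sets `{t}` and `Set.Ioi t`. -/
lemma indepFun_future {Ω : Type*} [MeasurableSpace Ω] {μ : Measure Ω} {Z : ℕ → Ω → Bool}
    (hZm : ∀ t, Measurable (Z t)) (hZ : iIndepFun Z μ) (t : ℕ) :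
    IndepFun (Z t) (fun ω s => Z (t + 1 + s) ω) μ := by
  have h := indep_iSup_of_disjoint (fun i => (hZm i).comap_le) hZ.iIndep
    (S := {t}) (T := Set.Ioi t) (by simp)
  rw [IndepFun_iff_Indep]
  refine indep_of_indep_of_le_right (indep_of_indep_of_le_left h ?_) ?_
  · exact le_iSup₂_of_le (f := fun i (_ : i ∈ ({t} : Set ℕ)) =>
      MeasurableSpace.comap (Z i) inferInstance) t (Set.mem_singleton t) le_rfl
  · simp only [MeasurableSpace.pi, MeasurableSpace.comap_iSup, MeasurableSpace.comap_comp]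
    refine iSup_le fun s => ?_
    exact le_iSup₂_of_le (f := fun i (_ : i ∈ Set.Ioi t) => MeasurableSpace.comap (Z i) inferInstance)
      (t + 1 + s) (by simp; omega) le_rfl

lemma obs_succ_eq_iff {Ω : Type*} (G Y : ℕ → Ω → Bool) (t : ℕ) (x : Fin (t + 1) → Bool × Bool)
    (ω : Ω) : obs G Y (t + 1) ω = x ↔
      obs G Y t ω = Fin.init x ∧ G t ω = (x (Fin.last t)).1 ∧ Y t ω = (x (Fin.last t)).2 := by
  constructor
  · rintro rfl
    exact ⟨rfl, rfl, rfl⟩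
  · rintro ⟨h1, h2, h3⟩
    funext s
    refine Fin.lastCases ?_ (fun i => ?_) s
    · exact Prod.ext h2 h3
    · exact congrFun h1 i

lemma IsDEDProcess.measurable_obs {Ω : Type*} [MeasurableSpace Ω] {μ : Measure Ω} {K D : ℕ}
    {p : ℕ → ℝ} {γ : Fin K → ℝ} {G Y : ℕ → Ω → Bool} (h : IsDEDProcess μ K D p Φ γ G Y) (t : ℕ) :
    Measurable (obs G Y t) :=
  measurable_pi_lambda _ fun s => (h.measurable_G s).prodMk (h.measurable_Y s)

/-- The finite-horizon likelihood of a dead-time event detection process. -/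
theorem IsDEDProcess.obsLaw_real_singleton {Ω : Type*} [MeasurableSpace Ω] {μ : Measure Ω}
    [IsProbabilityMeasure μ] {K D : ℕ} {p : ℕ → ℝ} {γ : Fin K → ℝ} {G Y : ℕ → Ω → Bool}
    (h : IsDEDProcess μ K D p Φ γ G Y) (hΦ : ∀ t, Measurable (Function.uncurry (Φ t))) (t : ℕ)
    (x : Fin t → Bool × Bool) :
    (obsLaw μ G Y t).real {x} = gateWeight Φ t x * ∏ s : Fin t, eventWeight (p s) (x s) := by
  obtain ⟨Z, U, hZm, hUm, hZp, hZi, hUl, hUi, hG, hY⟩ := h.exists_latent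
  -- Carrying an arbitrary event `S` about the future of `Z` through the induction encodes that this
  -- future is independent of the past observations, which is needed to split off `Z t` at the next
  -- step.
  have key : ∀ (t : ℕ) (x : Fin t → Bool × Bool) (S : Set (ℕ → Bool)), MeasurableSet S →
      μ.real {ω | obs G Y t ω = x ∧ (fun s => Z (t + s) ω) ∈ S} =
        (gateWeight Φ t x * ∏ s : Fin t, eventWeight (p s) (x s)) *
          μ.real {ω | (fun s => Z (t + s) ω) ∈ S} := by
    intro t
    induction t with
    | zero =>
      intro x S _
      simp [gateWeight, Subsingleton.elim _ x]
    | succ t ih =>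
      intro x S hS
      set g := (x (Fin.last t)).1
      set y := (x (Fin.last t)).2
      set S₁ : Set Bool := {z | y = (g && z)}
      -- Once the gate value is `g`, observing `y` at time `t` is a condition on `Z t` alone. It is
      -- absorbed into the event on the future, so that the induction hypothesis applies to
      -- `Fin.init x` and `S'`.
      set S' : Set (ℕ → Bool) := {z | z 0 ∈ S₁ ∧ (fun s => z (s + 1)) ∈ S}
      have hS' : MeasurableSet S' := by
        refine MeasurableSet.inter ?_ ?_
        · exact (measurable_pi_apply (X := fun _ : ℕ => Bool) 0)
            (MeasurableSet.of_discrete (s := S₁))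
        · have hm : Measurable fun (z : ℕ → Bool) (s : ℕ) => z (s + 1) :=
            measurable_pi_lambda _ fun s => measurable_pi_apply (s + 1)
          exact hm hS
      have e1 : μ.real {ω | obs G Y (t + 1) ω = x ∧ (fun s => Z (t + 1 + s) ω) ∈ S} =
          μ.real (U t ⁻¹' {u | Φ t (Fin.init x) u = g} ∩
            {ω | obs G Y t ω = Fin.init x ∧ (fun s => Z (t + s) ω) ∈ S'}) := by
        refine measureReal_congr ?_
        filter_upwards [hG t, hY t] with ω h1 h2
        refine propext ?_
        have hs : (fun s => Z (t + (s + 1)) ω) = fun s => Z (t + 1 + s) ω :=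
          funext fun s => by rw [add_comm s 1, add_assoc]
        change (obs G Y (t + 1) ω = x ∧ (fun s => Z (t + 1 + s) ω) ∈ S) ↔
          (Φ t (Fin.init x) (U t ω) = g ∧ obs G Y t ω = Fin.init x ∧
            (y = (g && Z (t + 0) ω) ∧ (fun s => Z (t + (s + 1)) ω) ∈ S))
        rw [hs, add_zero, obs_succ_eq_iff]
        constructor
        · rintro ⟨⟨a, b, c⟩, d⟩
          refine ⟨?_, a, ?_, d⟩
          · rw [← a, ← h1, b]
          · exact (c.symm.trans h2).trans (by rw [b])
        · rintro ⟨a, b, c, d⟩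
          have hg : G t ω = g := by rw [h1, b, a]
          refine ⟨⟨b, hg, ?_⟩, d⟩
          rw [h2, hg, ← c]
      have hΦm : MeasurableSet {u | Φ t (Fin.init x) u = g} :=
        measurable_gating_apply hΦ t _ (measurableSet_singleton g)
      have e2 : μ.real (U t ⁻¹' {u | Φ t (Fin.init x) u = g} ∩
            {ω | obs G Y t ω = Fin.init x ∧ (fun s => Z (t + s) ω) ∈ S'}) =
          gateProb Φ t (Fin.init x) g *
            μ.real {ω | obs G Y t ω = Fin.init x ∧ (fun s => Z (t + s) ω) ∈ S'} := by
        have hm : MeasurableSet {q : (ℕ → Bool) × (Fin t → Bool × Bool) |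
            q.2 = Fin.init x ∧ (fun s => q.1 (t + s)) ∈ S'} := by
          refine MeasurableSet.inter ?_ ?_
          · exact measurable_snd (measurableSet_singleton (Fin.init x))
          · have hm : Measurable fun (z : ℕ → Bool) (s : ℕ) => z (t + s) :=
              measurable_pi_lambda _ fun s => measurable_pi_apply (t + s)
            exact (hm.comp measurable_fst) hS'
        have := (hUi t).measure_inter_preimage_eq_mul _ _ hΦm hm
        have hU : μ.real (U t ⁻¹' {u | Φ t (Fin.init x) u = g}) = gateProb Φ t (Fin.init x) g := by
          rw [gateProb, ← (hUl t).map_eq, map_measureReal_apply (hUm t) hΦm]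
        rw [← hU, measureReal_def, measureReal_def, measureReal_def, ← ENNReal.toReal_mul]
        exact congrArg ENNReal.toReal this
      have e3 : μ.real {ω | (fun s => Z (t + s) ω) ∈ S'} =
          eventWeight (p t) (x (Fin.last t)) * μ.real {ω | (fun s => Z (t + 1 + s) ω) ∈ S} := by
        have := (indepFun_future hZm hZi t).measure_inter_preimage_eq_mul S₁ S
          (MeasurableSet.of_discrete) hS
        have hset : {ω | (fun s => Z (t + s) ω) ∈ S'} =
            Z t ⁻¹' S₁ ∩ (fun ω s => Z (t + 1 + s) ω) ⁻¹' S := by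
          ext ω
          change (Z (t + 0) ω ∈ S₁ ∧ (fun s => Z (t + (s + 1)) ω) ∈ S) ↔ _
          have hs : (fun s => Z (t + (s + 1)) ω) = fun s => Z (t + 1 + s) ω :=
            funext fun s => by rw [add_comm s 1, add_assoc]
          rw [hs, add_zero]
          rfl
        have hcompl : μ.real (Z t ⁻¹' {false}) = 1 - p t := by
          have hc := probReal_compl_eq_one_sub (μ := μ) (hZm t (measurableSet_singleton true))
          rw [← hZp t]
          refine Eq.trans ?_ hc
          congr 1
          ext ω
          simp
        have hZw : μ.real (Z t ⁻¹' S₁) = eventWeight (p t) (x (Fin.last t)) := by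
          change _ = eventWeight (p t) (g, y)
          cases hg : g <;> cases hy : y
          · have : S₁ = Set.univ := by ext z; simp [S₁, hg, hy]
            rw [this, Set.preimage_univ, probReal_univ]
            simp [eventWeight]
          · have : S₁ = ∅ := by ext z; simp [S₁, hg, hy]
            simp [this, eventWeight]
          · have : S₁ = {false} := by ext z; simp [S₁, hg, hy]
            simp [this, eventWeight, hcompl]
          · have : S₁ = {true} := by ext z; simp [S₁, hg, hy]
            rw [this]
            exact (hZp t).trans (by simp [eventWeight])
        rw [hset, ← hZw, measureReal_def, measureReal_def, measureReal_def, ← ENNReal.toReal_mul]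
        exact congrArg ENNReal.toReal this
      rw [e1, e2, ih _ _ hS', e3, gateWeight, Fin.prod_univ_castSucc]
      simp only [Fin.init, Fin.val_castSucc, Fin.val_last, g]
      ring
  have := key t x Set.univ MeasurableSet.univ
  simp only [Set.mem_univ, and_true, Set.ofPred_true, probReal_univ, mul_one] at this
  rw [obsLaw, map_measureReal_apply (h.measurable_obs t) (measurableSet_singleton x), ← this]
  rfl

lemma sum_fin_succ_fun {α M : Type*} [Fintype α] [AddCommMonoid M] (t : ℕ)
    (F : (Fin (t + 1) → α) → M) :
    ∑ x, F x = ∑ y : Fin t → α, ∑ a, F (Fin.snoc y a) := by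
  rw [← (Fin.snocEquiv fun _ : Fin (t + 1) => α).sum_comp, Fintype.sum_prod_type,
    Finset.sum_comm]
  rfl

/-- The tower property: average over the last event given the last gate, then over the gate given
the past. The weights `q` may be complex, so that they can also carry characteristic-function
factors. -/
lemma sum_gateWeight_succ {𝕜 : Type*} [RCLike 𝕜] (t : ℕ) (q : ℕ → Bool × Bool → 𝕜)
    (F : (Fin t → Bool × Bool) → Bool × Bool → 𝕜) :
    ∑ x : Fin (t + 1) → Bool × Bool, (gateWeight Φ (t + 1) x : 𝕜) * (∏ s : Fin (t + 1), q s (x s)) *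
        F (Fin.init x) (x (Fin.last t)) =
      ∑ y : Fin t → Bool × Bool, (gateWeight Φ t y : 𝕜) * (∏ s : Fin t, q s (y s)) *
        ∑ g, (gateProb Φ t y g : 𝕜) * ∑ b, q t (g, b) * F y (g, b) := by
  rw [sum_fin_succ_fun]
  refine Finset.sum_congr rfl fun y _ => ?_
  rw [Fintype.sum_prod_type, Finset.mul_sum]
  refine Finset.sum_congr rfl fun g _ => ?_
  rw [Finset.mul_sum, Finset.mul_sum]
  refine Finset.sum_congr rfl fun b _ => ?_
  simp only [gateWeight, Fin.prod_univ_castSucc, Fin.init_snoc, Fin.snoc_castSucc, Fin.snoc_last,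
    Fin.val_castSucc, Fin.val_last]
  push_cast
  ring

/-- Weights that are conditionally normalized have total mass one. -/
lemma sum_gateWeight_mul_prod_eq_one {𝕜 : Type*} [RCLike 𝕜]
    (hΦ : ∀ t, Measurable (Function.uncurry (Φ t))) (q : ℕ → Bool × Bool → 𝕜)
    (hq : ∀ s g, ∑ b, q s (g, b) = 1) (t : ℕ) :
    ∑ x : Fin t → Bool × Bool, (gateWeight Φ t x : 𝕜) * ∏ s : Fin t, q s (x s) = 1 := by
  induction t with
  | zero => simp [gateWeight]
  | succ t ih =>
    have h := sum_gateWeight_succ (Φ := Φ) t q fun _ _ => 1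
    simp only [mul_one, hq] at h
    rw [h, ← ih]
    refine Finset.sum_congr rfl fun y _ => ?_
    have := congrArg (fun r : ℝ => (r : 𝕜)) (sum_gateProb hΦ t y)
    push_cast at this
    rw [this, mul_one]

/-- Bounds the second moment of the likelihood ratio, whose one-step weights have mass slightly
above one. -/
lemma sum_gateWeight_mul_prod_le_pow (hΦ : ∀ t, Measurable (Function.uncurry (Φ t)))
    (q : ℕ → Bool × Bool → ℝ) (hq0 : ∀ s x, 0 ≤ q s x) {c : ℝ} (hc : 0 ≤ c)
    (hq : ∀ s g, ∑ b, q s (g, b) ≤ c) (t : ℕ) :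
    ∑ x : Fin t → Bool × Bool, gateWeight Φ t x * ∏ s : Fin t, q s (x s) ≤ c ^ t := by
  induction t with
  | zero => simp [gateWeight]
  | succ t ih =>
    have h := sum_gateWeight_succ (Φ := Φ) t q fun _ _ => 1
    simp only [mul_one, RCLike.ofReal_real_eq_id, id] at h
    rw [h, pow_succ]
    refine le_trans ?_ (mul_le_mul_of_nonneg_right ih hc)
    rw [Finset.sum_mul]
    refine Finset.sum_le_sum fun y _ => ?_
    refine mul_le_mul_of_nonneg_left ?_
      (mul_nonneg (gateWeight_nonneg _ _) (Finset.prod_nonneg fun s _ => hq0 _ _))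
    calc ∑ g, gateProb Φ t y g * ∑ b, q t (g, b) ≤ ∑ g, gateProb Φ t y g * c :=
          Finset.sum_le_sum fun g _ => mul_le_mul_of_nonneg_left (hq _ _) (gateProb_nonneg _ _ _)
      _ = c := by rw [← Finset.sum_mul, sum_gateProb hΦ, one_mul]

/-- The second moment of a sum of conditionally centred increments. -/
lemma sum_gateWeight_mul_sq_le (hΦ : ∀ t, Measurable (Function.uncurry (Φ t)))
    (q w : ℕ → Bool × Bool → ℝ) (hq0 : ∀ s x, 0 ≤ q s x) (hq : ∀ s g, ∑ b, q s (g, b) = 1)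
    (hw : ∀ s g, ∑ b, q s (g, b) * w s (g, b) = 0) {c : ℝ}
    (hc : ∀ s g, ∑ b, q s (g, b) * w s (g, b) ^ 2 ≤ c) (t : ℕ) :
    ∑ x : Fin t → Bool × Bool, gateWeight Φ t x * (∏ s : Fin t, q s (x s)) * (∑ s : Fin t, w s (x s)) ^ 2 ≤
      t * c := by
  induction t with
  | zero => simp
  | succ t ih =>
    have h := sum_gateWeight_succ (Φ := Φ) t q fun y a => (∑ s : Fin t, w s (y s) + w t a) ^ 2
    simp only [RCLike.ofReal_real_eq_id, id] at h
    simp only [Fin.sum_univ_castSucc, Fin.val_castSucc, Fin.val_last]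
    refine (le_of_eq h).trans ?_
    have hone := sum_gateWeight_mul_prod_eq_one hΦ q hq t
    simp only [RCLike.ofReal_real_eq_id, id] at hone
    have hstep : ∀ y : Fin t → Bool × Bool,
        ∑ g, gateProb Φ t y g * ∑ b, q t (g, b) * (∑ s : Fin t, w s (y s) + w t (g, b)) ^ 2 ≤
          (∑ s : Fin t, w s (y s)) ^ 2 + c := by
      intro y
      set A := ∑ s : Fin t, w s (y s)
      -- The cross term drops out because the new increment is centred given the past and the gate.
      have hb : ∀ g, ∑ b, q t (g, b) * (A + w t (g, b)) ^ 2 ≤ A ^ 2 + c := by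
        intro g
        have h1 := hq t g
        have h2 := hw t g
        have h3 := hc t g
        rw [Fintype.sum_bool] at h1 h2 h3 ⊢
        linear_combination A ^ 2 * h1 + 2 * A * h2 + h3
      calc _ ≤ ∑ g, gateProb Φ t y g * (A ^ 2 + c) :=
            Finset.sum_le_sum fun g _ => mul_le_mul_of_nonneg_left (hb g) (gateProb_nonneg _ _ _)
        _ = A ^ 2 + c := by rw [← Finset.sum_mul, sum_gateProb hΦ, one_mul]
    calc _ ≤ ∑ y : Fin t → Bool × Bool, gateWeight Φ t y * (∏ s : Fin t, q s (y s)) *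
          ((∑ s : Fin t, w s (y s)) ^ 2 + c) :=
          Finset.sum_le_sum fun y _ => mul_le_mul_of_nonneg_left (hstep y)
            (mul_nonneg (gateWeight_nonneg _ _) (Finset.prod_nonneg fun s _ => hq0 _ _))
      _ ≤ _ := by
          simp only [mul_add, Finset.sum_add_distrib, ← Finset.sum_mul]
          rw [hone]
          push_cast
          linarith

end Likelihood

end DED

namespace DED

/-! ### Measures on countable and finite spaces. -/

section FiniteMeasure

variable {α : Type*} [MeasurableSpace α]

/-- At an atom of `ν` the density is determined pointwise, as the ratio of the two masses. -/
lemma llr_eq_log_div [MeasurableSingletonClass α] {μ ν : Measure α}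
    [IsFiniteMeasure μ] [IsFiniteMeasure ν] (h : μ ≪ ν) {x : α} (hx : ν {x} ≠ 0) :
    llr μ ν x = Real.log (μ.real {x} / ν.real {x}) := by
  have h1 : μ {x} = μ.rnDeriv ν x * ν {x} := by
    conv_lhs => rw [← Measure.withDensity_rnDeriv_eq μ ν h]
    rw [withDensity_apply _ (measurableSet_singleton x), lintegral_singleton]
  have h2 : μ.real {x} = (μ.rnDeriv ν x).toReal * ν.real {x} := by
    rw [measureReal_def, h1, ENNReal.toReal_mul, measureReal_def]
  have h3 : ν.real {x} ≠ 0 := by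
    rw [measureReal_def]
    exact (ENNReal.toReal_pos hx (measure_ne_top _ _)).ne'
  rw [llr, h2, mul_div_cancel_right₀ _ h3]

lemma absolutelyContinuous_of_singleton [Countable α] {μ ν : Measure α}
    (h : ∀ x, ν {x} = 0 → μ {x} = 0) : μ ≪ ν := by
  refine Measure.AbsolutelyContinuous.mk fun s _ hs => ?_
  rw [← Set.biUnion_of_singleton s, measure_biUnion_null_iff s.to_countable]
  exact fun x hx => h x (measure_mono_null (Set.singleton_subset_iff.2 hx) hs)

/-- Markov's inequality for the `k`-th absolute moment. -/
lemma measure_le_abs_le_ofReal [Finite α] [MeasurableSingletonClass α] (μ : Measure α)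
    [IsProbabilityMeasure μ] (X : α → ℝ) {ε : ℝ} (hε : 0 < ε) (k : ℕ) :
    μ {x | ε ≤ |X x|} ≤ ENNReal.ofReal ((∫ x, |X x| ^ k ∂μ) / ε ^ k) := by
  have h := mul_meas_ge_le_integral_of_nonneg (μ := μ) (f := fun x => |X x| ^ k)
    (Eventually.of_forall fun x => by positivity) Integrable.of_finite (ε ^ k)
  have hsub : μ.real {x | ε ≤ |X x|} ≤ μ.real {x | ε ^ k ≤ |X x| ^ k} :=
    measureReal_mono fun x (hx : ε ≤ |X x|) => pow_le_pow_left₀ hε.le hx k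
  rw [← ofReal_measureReal]
  refine ENNReal.ofReal_le_ofReal ?_
  rw [le_div_iff₀ (by positivity)]
  nlinarith [pow_pos hε k]

end FiniteMeasure

/-! ### Convergence in probability and contiguity along a sequence of spaces. -/

section LittleO

variable {α : ℕ → Type*} [∀ t, MeasurableSpace (α t)] {R : (t : ℕ) → Measure (α t)}

lemma IsLittleOInProb.of_tendsto_integral [∀ t, Finite (α t)]
    [∀ t, MeasurableSingletonClass (α t)] [∀ t, IsProbabilityMeasure (R t)]
    {X : (t : ℕ) → α t → ℝ} (k : ℕ) (h : Tendsto (fun t => ∫ x, |X t x| ^ k ∂(R t)) atTop (𝓝 0)) :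
    IsLittleOInProb R X := by
  intro ε hε
  refine tendsto_of_tendsto_of_tendsto_of_le_of_le tendsto_const_nhds ?_ (fun _ => zero_le)
    (fun t => measure_le_abs_le_ofReal (R t) (X t) hε k)
  have := ENNReal.tendsto_ofReal (h.div_const (ε ^ k))
  simpa using this

lemma IsLittleOInProb.add {X X' : (t : ℕ) → α t → ℝ} (h : IsLittleOInProb R X)
    (h' : IsLittleOInProb R X') : IsLittleOInProb R (fun t x => X t x + X' t x) := by
  intro ε hε
  refine tendsto_of_tendsto_of_tendsto_of_le_of_le tendsto_const_nhds
    (by simpa using (h (ε / 2) (half_pos hε)).add (h' (ε / 2) (half_pos hε))) (fun _ => zero_le)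
    (fun t => (measure_mono ?_).trans (measure_union_le _ _))
  intro x (hx : ε ≤ |X t x + X' t x|)
  by_contra hcon
  simp only [Set.mem_union, Set.mem_ofPred_eq, not_or, not_le] at hcon
  linarith [abs_add_le (X t x) (X' t x), hcon.1, hcon.2]

lemma IsLittleOInProb.congr {X X' : (t : ℕ) → α t → ℝ} (h : IsLittleOInProb R X)
    (hX : ∀ᶠ t in atTop, X t =ᵐ[R t] X' t) : IsLittleOInProb R X' := by
  intro ε hε
  refine (h ε hε).congr' ?_
  filter_upwards [hX] with t ht
  refine measure_congr ?_
  filter_upwards [ht] with x hx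
  exact propext (show ε ≤ |X t x| ↔ ε ≤ |X' t x| by rw [hx])

lemma Contiguous.of_sq_le {Q : (t : ℕ) → Measure (α t)} [∀ t, IsFiniteMeasure (Q t)]
    [∀ t, IsFiniteMeasure (R t)] (C : ℝ)
    (h : ∀ᶠ t in atTop, ∀ A : Set (α t), (Q t).real A ^ 2 ≤ C * (R t).real A) :
    Contiguous Q R := by
  intro A _ hR
  have hR' : Tendsto (fun t => (R t).real (A t)) atTop (𝓝 0) := by
    simpa [measureReal_def, Function.comp_def] using (ENNReal.tendsto_toReal ENNReal.zero_ne_top).comp hR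
  have hQ : Tendsto (fun t => (Q t).real (A t) ^ 2) atTop (𝓝 0) := by
    refine tendsto_of_tendsto_of_tendsto_of_le_of_le' tendsto_const_nhds
      (by simpa using hR'.const_mul C) (Eventually.of_forall fun _ => sq_nonneg _) ?_
    filter_upwards [h] with t ht using ht _
  have hQ' : Tendsto (fun t => (Q t).real (A t)) atTop (𝓝 0) := by
    have := (Real.continuous_sqrt.tendsto 0).comp hQ
    simpa [Function.comp_def, Real.sqrt_sq measureReal_nonneg] using this
  have := ENNReal.tendsto_ofReal hQ'
  simpa [ofReal_measureReal] using this

end LittleO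

/-! ### Likelihood ratios of two processes with common gating rules. -/

section ObsLaw

variable {Φ : (t : ℕ) → (Fin t → Bool × Bool) → unitInterval → Bool}
  {Ω : Type*} [MeasurableSpace Ω] {μ : Measure Ω} [IsProbabilityMeasure μ] {K D : ℕ}
  {p : ℕ → ℝ} {γ : Fin K → ℝ} {G Y : ℕ → Ω → Bool}

lemma IsDEDProcess.isProbabilityMeasure_obsLaw (h : IsDEDProcess μ K D p Φ γ G Y) (t : ℕ) :
    IsProbabilityMeasure (obsLaw μ G Y t) :=
  Measure.isProbabilityMeasure_map (h.measurable_obs t).aemeasurable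

lemma IsDEDProcess.integral_obsLaw {E : Type*} [NormedAddCommGroup E] [NormedSpace ℝ E]
    [CompleteSpace E] (h : IsDEDProcess μ K D p Φ γ G Y)
    (hΦ : ∀ t, Measurable (Function.uncurry (Φ t))) (t : ℕ) (f : (Fin t → Bool × Bool) → E) :
    ∫ x, f x ∂(obsLaw μ G Y t) =
      ∑ x, (gateWeight Φ t x * ∏ s : Fin t, eventWeight (p s) (x s)) • f x := by
  have := h.isProbabilityMeasure_obsLaw t
  rw [integral_fintype Integrable.of_finite]
  simp_rw [h.obsLaw_real_singleton hΦ]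

lemma sum_eventWeight (q : ℝ) (g : Bool) : ∑ b, eventWeight q (g, b) = 1 := by
  cases g <;> simp [eventWeight]

/-- The support of the weight is the same for all nondegenerate parameters; mutual absolute
continuity rests on this. -/
lemma eventWeight_eq_zero_iff {q q' : ℝ} (hq : q ∈ Set.Ioo (0 : ℝ) 1)
    (hq' : q' ∈ Set.Ioo (0 : ℝ) 1) (x : Bool × Bool) :
    eventWeight q x = 0 ↔ eventWeight q' x = 0 := by
  obtain ⟨g, b⟩ := x
  have := hq.1; have := hq.2; have := hq'.1; have := hq'.2
  cases g <;> cases b <;> simp [eventWeight]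
  · constructor <;> intro <;> linarith
  · constructor <;> intro <;> linarith

lemma obsLaw_absolutelyContinuous {Ω' : Type*} [MeasurableSpace Ω'] {μ' : Measure Ω'}
    [IsProbabilityMeasure μ'] {p' : ℕ → ℝ} {γ' : Fin K → ℝ} {G' Y' : ℕ → Ω' → Bool}
    (h : IsDEDProcess μ K D p Φ γ G Y) (h' : IsDEDProcess μ' K D p' Φ γ' G' Y')
    (hΦ : ∀ t, Measurable (Function.uncurry (Φ t)))
    (hp : ∀ s, p s ∈ Set.Ioo (0 : ℝ) 1) (hp' : ∀ s, p' s ∈ Set.Ioo (0 : ℝ) 1) (t : ℕ) :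
    obsLaw μ' G' Y' t ≪ obsLaw μ G Y t := by
  have := h.isProbabilityMeasure_obsLaw t
  have := h'.isProbabilityMeasure_obsLaw t
  refine absolutelyContinuous_of_singleton fun x hx => ?_
  rw [← measureReal_eq_zero_iff] at hx ⊢
  rw [h.obsLaw_real_singleton hΦ, mul_eq_zero, Finset.prod_eq_zero_iff] at hx
  rw [h'.obsLaw_real_singleton hΦ, mul_eq_zero, Finset.prod_eq_zero_iff]
  exact hx.imp_right fun ⟨s, hs, h0⟩ => ⟨s, hs, (eventWeight_eq_zero_iff (hp s) (hp' s) _).1 h0⟩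

/-- The log-likelihood ratio of two processes with the same gating rules is additive. -/
lemma llr_obsLaw {Ω' : Type*} [MeasurableSpace Ω'] {μ' : Measure Ω'}
    [IsProbabilityMeasure μ'] {p' : ℕ → ℝ} {γ' : Fin K → ℝ} {G' Y' : ℕ → Ω' → Bool}
    (h : IsDEDProcess μ K D p Φ γ G Y) (h' : IsDEDProcess μ' K D p' Φ γ' G' Y')
    (hΦ : ∀ t, Measurable (Function.uncurry (Φ t)))
    (hp : ∀ s, p s ∈ Set.Ioo (0 : ℝ) 1) (hp' : ∀ s, p' s ∈ Set.Ioo (0 : ℝ) 1) (t : ℕ) :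
    llr (obsLaw μ' G' Y' t) (obsLaw μ G Y t) =ᵐ[obsLaw μ G Y t]
      fun x => ∑ s : Fin t, Real.log (eventWeight (p' s) (x s) / eventWeight (p s) (x s)) := by
  have := h.isProbabilityMeasure_obsLaw t
  have := h'.isProbabilityMeasure_obsLaw t
  rw [Filter.EventuallyEq, ae_iff_of_countable]
  intro x hx
  rw [llr_eq_log_div (obsLaw_absolutelyContinuous h h' hΦ hp hp' t) hx]
  have hx' : (obsLaw μ G Y t).real {x} ≠ 0 := fun h0 => hx ((measureReal_eq_zero_iff).1 h0)
  rw [h.obsLaw_real_singleton hΦ] at hx' ⊢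
  rw [h'.obsLaw_real_singleton hΦ]
  have hg := left_ne_zero_of_mul hx'
  have hw := Finset.prod_ne_zero_iff.1 (right_ne_zero_of_mul hx')
  rw [mul_div_mul_left _ _ hg, ← Finset.prod_div_distrib, Real.log_prod]
  intro s hs
  exact div_ne_zero (fun h0 => hw s hs ((eventWeight_eq_zero_iff (hp s) (hp' s) _).2 h0)) (hw s hs)

/-- In the active state the sum is one plus the chi-square divergence of the Bernoulli laws. In the
inactive state it is `1`, the impossible outcome contributing `0 / 0 = 0`. -/
lemma sum_eventWeight_sq_div_le {q q' c : ℝ} (hq : q ∈ Set.Ioo (0 : ℝ) 1)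
    (hc : (q' - q) ^ 2 / (q * (1 - q)) ≤ c) (g : Bool) :
    ∑ b, eventWeight q' (g, b) ^ 2 / eventWeight q (g, b) ≤ 1 + c := by
  have h1 : 0 < q := hq.1
  have h2 : 0 < 1 - q := sub_pos.2 hq.2
  have h3 : 0 ≤ (q' - q) ^ 2 / (q * (1 - q)) := by positivity
  cases g
  · simp [eventWeight]
    linarith
  · have : q' ^ 2 / q + (1 - q') ^ 2 / (1 - q) = 1 + (q' - q) ^ 2 / (q * (1 - q)) := by
      field_simp
      ring
    simp [eventWeight]
    linarith

/-- A bound of the likelihood ratio in mean square controls one law by the other. -/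
lemma obsLaw_real_sq_le {Ω' : Type*} [MeasurableSpace Ω'] {μ' : Measure Ω'}
    [IsProbabilityMeasure μ'] {p' : ℕ → ℝ} {γ' : Fin K → ℝ} {G' Y' : ℕ → Ω' → Bool}
    (h : IsDEDProcess μ K D p Φ γ G Y) (h' : IsDEDProcess μ' K D p' Φ γ' G' Y')
    (hΦ : ∀ t, Measurable (Function.uncurry (Φ t)))
    (hp : ∀ s, p s ∈ Set.Ioo (0 : ℝ) 1) (hp' : ∀ s, p' s ∈ Set.Ioo (0 : ℝ) 1) {c : ℝ}
    (hc0 : 0 ≤ c) (hc : ∀ s, (p' s - p s) ^ 2 / (p s * (1 - p s)) ≤ c) (t : ℕ)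
    (A : Set (Fin t → Bool × Bool)) :
    (obsLaw μ' G' Y' t).real A ^ 2 ≤ (1 + c) ^ t * (obsLaw μ G Y t).real A := by
  classical
  have := h.isProbabilityMeasure_obsLaw t
  have := h'.isProbabilityMeasure_obsLaw t
  have hp0 : ∀ s x, 0 ≤ eventWeight (p s) x := fun s =>
    eventWeight_nonneg ⟨(hp s).1.le, (hp s).2.le⟩
  have hq0 : ∀ s x, 0 ≤ eventWeight (p' s) x ^ 2 / eventWeight (p s) x := fun s x =>
    div_nonneg (sq_nonneg _) (hp0 s x)
  rw [← Set.coe_toFinset A, ← sum_measureReal_singleton, ← sum_measureReal_singleton]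
  -- Cauchy-Schwarz with `f` equal to the squared likelihood ratio times the reference mass; its
  -- total is the second moment of the ratio.
  have hcs := Finset.sum_sq_le_sum_mul_sum_of_sq_le_mul A.toFinset
    (r := fun x => (obsLaw μ' G' Y' t).real {x})
    (f := fun x => gateWeight Φ t x *
      ∏ s : Fin t, eventWeight (p' s) (x s) ^ 2 / eventWeight (p s) (x s))
    (g := fun x => (obsLaw μ G Y t).real {x})
    (fun x _ => mul_nonneg (gateWeight_nonneg _ _) (Finset.prod_nonneg fun s _ => hq0 _ _))
    (fun x _ => measureReal_nonneg) (fun x _ => ?_)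
  · refine hcs.trans (mul_le_mul_of_nonneg_right ?_
      (Finset.sum_nonneg fun _ _ => measureReal_nonneg))
    refine le_trans (Finset.sum_le_sum_of_subset_of_nonneg (Finset.subset_univ _) fun x _ _ => ?_)
      (sum_gateWeight_mul_prod_le_pow hΦ
        (fun s x => eventWeight (p' s) x ^ 2 / eventWeight (p s) x) hq0 (by linarith)
        (fun s g => sum_eventWeight_sq_div_le (hp s) (hc s) g) t)
    exact mul_nonneg (gateWeight_nonneg _ _) (Finset.prod_nonneg fun s _ => hq0 _ _)
  · have hprod : (∏ s : Fin t, eventWeight (p' s) (x s) ^ 2 / eventWeight (p s) (x s)) *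
        ∏ s : Fin t, eventWeight (p s) (x s) = (∏ s : Fin t, eventWeight (p' s) (x s)) ^ 2 := by
      rw [← Finset.prod_mul_distrib, ← Finset.prod_pow]
      refine Finset.prod_congr rfl fun s _ => ?_
      -- Where the denominator vanishes the numerator does too, by equality of supports.
      refine div_mul_cancel_of_imp fun h0 => ?_
      rw [(eventWeight_eq_zero_iff (hp s) (hp' s) _).1 h0]
      ring
    simp only [h.obsLaw_real_singleton hΦ, h'.obsLaw_real_singleton hΦ]
    rw [mul_pow, ← hprod]
    exact le_of_eq (by ring)

end ObsLaw

end DED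

namespace DED

/-! ### Laws of large numbers driven by the gating frequencies. -/

section GatingAverage

variable {Φ : (t : ℕ) → (Fin t → Bool × Bool) → unitInterval → Bool}
  {Ω : Type*} [MeasurableSpace Ω] {μ : Measure Ω} [IsProbabilityMeasure μ] {K D : ℕ}
  {p : ℕ → ℝ} {γ : Fin K → ℝ} {G Y : ℕ → Ω → Bool}

lemma bit_mem (b : Bool) : bit b ∈ Set.Icc (0 : ℝ) 1 := by
  cases b <;> simp [bit]

/-- Bounded convergence: the integrand is below `ε / 2` off a set of vanishing measure, and at most
`C` on it. -/
lemma tendsto_integral_abs_sub_of_tendstoInMeasure {f : ℕ → Ω → ℝ} {c C : ℝ}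
    (hm : ∀ n, Measurable (f n)) (hC : ∀ n ω, |f n ω - c| ≤ C)
    (h : TendstoInMeasure μ f atTop fun _ => c) :
    Tendsto (fun n => ∫ ω, |f n ω - c| ∂μ) atTop (𝓝 0) := by
  have hC0 : 0 ≤ C := by
    obtain ⟨ω⟩ := nonempty_of_isProbabilityMeasure μ
    exact (abs_nonneg _).trans (hC 0 ω)
  rw [Metric.tendsto_atTop]
  intro ε hε
  rw [tendstoInMeasure_iff_norm] at h
  have h1 := (ENNReal.tendsto_toReal ENNReal.zero_ne_top).comp (h (ε / 2) (half_pos hε))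
  have h2 : ∀ᶠ n in atTop, C * μ.real {ω | ε / 2 ≤ ‖f n ω - c‖} < ε / 2 := by
    have := h1.const_mul C
    simp only [ENNReal.toReal_zero, mul_zero] at this
    exact this.eventually_lt_const (half_pos hε)
  obtain ⟨N, hN⟩ := eventually_atTop.1 h2
  refine ⟨N, fun n hn => ?_⟩
  have hms : MeasurableSet {ω | ε / 2 ≤ ‖f n ω - c‖} :=
    measurableSet_le measurable_const ((hm n).sub_const c).norm
  have hint : Integrable (fun ω => |f n ω - c|) μ :=
    Integrable.of_bound ((hm n).sub_const c).abs.aestronglyMeasurable C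
      (Eventually.of_forall fun ω => by simpa using hC n ω)
  have hle : ∫ ω, |f n ω - c| ∂μ ≤ ε / 2 + C * μ.real {ω | ε / 2 ≤ ‖f n ω - c‖} := by
    calc ∫ ω, |f n ω - c| ∂μ
        ≤ ∫ ω, (ε / 2 + {ω | ε / 2 ≤ ‖f n ω - c‖}.indicator (fun _ => C) ω) ∂μ := by
          refine integral_mono hint
            ((integrable_const _).add ((integrable_const C).indicator hms)) fun ω => ?_
          change _ ≤ ε / 2 + _
          by_cases hω : ω ∈ {ω | ε / 2 ≤ ‖f n ω - c‖}
          · rw [Set.indicator_of_mem hω]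
            linarith [hC n ω]
          · rw [Set.indicator_of_notMem hω]
            have : ¬ ε / 2 ≤ |f n ω - c| := hω
            linarith
      _ = ε / 2 + C * μ.real {ω | ε / 2 ≤ ‖f n ω - c‖} := by
          rw [integral_add (integrable_const _) ((integrable_const C).indicator hms),
            integral_indicator_const _ hms]
          simp [mul_comm]
  rw [Real.dist_eq, sub_zero, abs_of_nonneg (integral_nonneg fun _ => abs_nonneg _)]
  linarith [hN n hn]

/-- The sum of `g` over the times before `t` in phase `r`, for the period `K`. -/
noncomputable def phaseSum (K r : ℕ) (g : ℕ → ℝ) (t : ℕ) : ℝ :=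
  ∑ s ∈ Finset.range t, if s % K = r then g s else 0

/-- Each complete block of `K` consecutive times contains phase `r` exactly once. -/
lemma phaseSum_mul {K r : ℕ} (hr : r < K) (g : ℕ → ℝ) (L : ℕ) :
    phaseSum K r g (L * K) = ∑ l ∈ Finset.range L, g (r + l * K) := by
  induction L with
  | zero => simp [phaseSum]
  | succ L ih =>
    rw [Finset.sum_range_succ, ← ih, phaseSum, phaseSum, add_mul, one_mul, Finset.sum_range_add]
    congr 1
    rw [Finset.sum_eq_single r]
    · rw [if_pos (by rw [mul_comm, Nat.mul_add_mod, Nat.mod_eq_of_lt hr]), add_comm]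
    · intro b hb hbr
      rw [if_neg]
      rwa [mul_comm, Nat.mul_add_mod, Nat.mod_eq_of_lt (Finset.mem_range.1 hb)]
    · exact fun h => absurd (Finset.mem_range.2 hr) h

lemma phaseSum_mem_Icc {K r : ℕ} {g : ℕ → ℝ} (hg : ∀ s, g s ∈ Set.Icc (0 : ℝ) 1) (t : ℕ) :
    phaseSum K r g t ∈ Set.Icc (0 : ℝ) t := by
  constructor
  · exact Finset.sum_nonneg fun s _ => by split_ifs; exacts [(hg s).1, le_rfl]
  · calc phaseSum K r g t ≤ ∑ s ∈ Finset.range t, (1 : ℝ) :=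
          Finset.sum_le_sum fun s _ => by split_ifs; exacts [(hg s).2, zero_le_one]
      _ = t := by simp

/-- The difference comes from the last, incomplete block, which has `t % K < K` times. -/
lemma abs_phaseSum_sub_le {K r : ℕ} (hr : r < K) {g : ℕ → ℝ} (hg : ∀ s, g s ∈ Set.Icc (0 : ℝ) 1)
    (t : ℕ) : |phaseSum K r g t - ∑ l ∈ Finset.range (t / K), g (r + l * K)| ≤ K := by
  rw [← phaseSum_mul hr]
  have ht : t / K * K + t % K = t := Nat.div_add_mod' t K
  have hsum : phaseSum K r g t - phaseSum K r g (t / K * K) =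
      ∑ s ∈ Finset.range (t % K),
        if (t / K * K + s) % K = r then g (t / K * K + s) else 0 := by
    rw [sub_eq_iff_eq_add', phaseSum, phaseSum, ← Finset.sum_range_add, ht]
  have hK : ((t % K : ℕ) : ℝ) ≤ K := by
    exact_mod_cast (Nat.mod_lt t (by omega)).le
  rw [hsum]
  refine (Finset.abs_sum_le_sum_abs _ _).trans (le_trans ?_ hK)
  calc _ ≤ ∑ s ∈ Finset.range (t % K), (1 : ℝ) := Finset.sum_le_sum fun s _ => by
        split_ifs
        · rw [abs_of_nonneg (hg _).1]
          exact (hg _).2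
        · simp
    _ = _ := by simp

lemma tendsto_natDiv_div {K : ℕ} (hK : 0 < K) :
    Tendsto (fun t : ℕ => ((t / K : ℕ) : ℝ) / t) atTop (𝓝 (1 / K)) := by
  have h := (tendsto_nat_floor_mul_div_atTop (R := ℝ) (a := 1 / K) (by positivity)).comp
    tendsto_natCast_atTop_atTop
  refine h.congr fun t => ?_
  have : ⌊(1 / K : ℝ) * (t : ℝ)⌋₊ = t / K := by
    rw [one_div_mul_eq_div, Nat.floor_div_natCast, Nat.floor_natCast]
  rw [Function.comp_apply, this]

/-- The activation frequency of a phase up to time `t` converges in mean. -/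
lemma IsDEDProcess.tendsto_integral_phaseSum (h : IsDEDProcess μ K D p Φ γ G Y) (r : Fin K) :
    Tendsto (fun t : ℕ => ∫ ω, |phaseSum K r (fun s => bit (G s ω)) t / t - γ r / K| ∂μ) atTop
      (𝓝 0) := by
  have hK : 0 < K := r.pos
  have hbit : ∀ s, Measurable fun ω => bit (G s ω) := fun s =>
    (measurable_of_countable bit).comp (h.measurable_G s)
  set A : ℕ → Ω → ℝ := fun L ω => (1 / (L : ℝ)) * ∑ l ∈ Finset.range L, bit (G ((r : ℕ) + l * K) ω)
    with hA
  have hAm : ∀ L, Measurable (A L) := fun L =>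
    (Finset.measurable_sum _ fun l _ => hbit _).const_mul _
  have hA01 : ∀ L ω, A L ω ∈ Set.Icc (0 : ℝ) 1 := by
    intro L ω
    have h0 : 0 ≤ ∑ l ∈ Finset.range L, bit (G ((r : ℕ) + l * K) ω) :=
      Finset.sum_nonneg fun l _ => (bit_mem _).1
    have h1 : ∑ l ∈ Finset.range L, bit (G ((r : ℕ) + l * K) ω) ≤ L :=
      (Finset.sum_le_sum fun l _ => (bit_mem _).2).trans (by simp)
    refine ⟨mul_nonneg (by positivity) h0, ?_⟩
    change 1 / (L : ℝ) * _ ≤ 1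
    rw [one_div_mul_eq_div]
    exact div_le_one_of_le₀ h1 (by positivity)
  have hγ := h.gamma_mem r
  have hAb : ∀ L ω, |A L ω - γ r| ≤ 1 := by
    intro L ω
    have := hA01 L ω
    rw [abs_le]
    constructor <;> linarith [this.1, this.2, hγ.1, hγ.2]
  have hlim := tendsto_integral_abs_sub_of_tendstoInMeasure hAm hAb (h.gating_frequency r)
  have hdiv : Tendsto (fun t : ℕ => t / K) atTop atTop := Nat.tendsto_div_const_atTop hK.ne'
  have hratio := tendsto_natDiv_div hK
  -- The three errors are the incomplete block, the deviation of the frequency over the `t / K`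
  -- complete blocks, and the discrepancy between `⌊t / K⌋ / t` and `1 / K`.
  have hbound : Tendsto (fun t : ℕ => (K : ℝ) / t + (((t / K : ℕ) : ℝ) / t) *
      ∫ ω, |A (t / K) ω - γ r| ∂μ + |γ r| * |((t / K : ℕ) : ℝ) / t - 1 / K|) atTop (𝓝 0) := by
    have h1 : Tendsto (fun t : ℕ => (K : ℝ) / t) atTop (𝓝 0) :=
      tendsto_const_div_atTop_nhds_zero_nat _
    have h2 := hratio.mul (hlim.comp hdiv)
    have h3 := ((hratio.sub_const (1 / (K : ℝ))).abs).const_mul |γ r|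
    simpa [Function.comp_def] using (h1.add h2).add h3
  refine tendsto_of_tendsto_of_tendsto_of_le_of_le' tendsto_const_nhds hbound
    (Eventually.of_forall fun t => integral_nonneg fun _ => abs_nonneg _) ?_
  filter_upwards [eventually_ge_atTop K] with t ht
  have ht0 : (0 : ℝ) < t := by exact_mod_cast hK.trans_le ht
  have hL : ((t / K : ℕ) : ℝ) ≠ 0 := by
    exact_mod_cast (Nat.div_pos ht hK).ne'
  have hintA : Integrable (fun ω => |A (t / K) ω - γ r|) μ :=
    Integrable.of_bound ((hAm _).sub_const _).abs.aestronglyMeasurable 1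
      (Eventually.of_forall fun ω => by simpa using hAb _ ω)
  have hint : Integrable
      (fun ω => (K : ℝ) / t + (((t / K : ℕ) : ℝ) / t) * |A (t / K) ω - γ r|) μ :=
    (integrable_const _).add (hintA.const_mul _)
  calc ∫ ω, |phaseSum K r (fun s => bit (G s ω)) t / t - γ r / K| ∂μ
      ≤ ∫ ω, ((K : ℝ) / t + (((t / K : ℕ) : ℝ) / t) * |A (t / K) ω - γ r| +
          |γ r| * |((t / K : ℕ) : ℝ) / t - 1 / K|) ∂μ := by
        refine integral_mono_of_nonneg (Eventually.of_forall fun _ => abs_nonneg _)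
          (hint.add (integrable_const _))
          (Eventually.of_forall fun ω => ?_)
        have hps := abs_phaseSum_sub_le r.isLt (fun s => bit_mem (G s ω)) t
        have hAS : ∑ l ∈ Finset.range (t / K), bit (G ((r : ℕ) + l * K) ω) =
            ((t / K : ℕ) : ℝ) * A (t / K) ω := by
          rw [hA]
          field_simp
        rw [hAS] at hps
        have hdec : phaseSum K r (fun s => bit (G s ω)) t / t - γ r / K =
            (phaseSum K r (fun s => bit (G s ω)) t - ((t / K : ℕ) : ℝ) * A (t / K) ω) / t +
            ((t / K : ℕ) : ℝ) / t * (A (t / K) ω - γ r) +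
            γ r * (((t / K : ℕ) : ℝ) / t - 1 / K) := by
          field_simp
          ring
        change |_| ≤ _
        rw [hdec]
        refine (abs_add_three _ _ _).trans ?_
        rw [abs_div, abs_mul, abs_mul, abs_of_pos ht0,
          abs_of_nonneg (show 0 ≤ ((t / K : ℕ) : ℝ) / t by positivity)]
        exact add_le_add (add_le_add (div_le_div_of_nonneg_right hps ht0.le) le_rfl) le_rfl
    _ = _ := by
        rw [integral_add hint (integrable_const _),
          integral_add (integrable_const _) (hintA.const_mul _), integral_const_mul]
        simp

lemma sum_bit_smul_eq_sum_phaseSum {E : Type*} [AddCommGroup E] [Module ℝ E] (hK : 0 < K)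
    {F : ℕ → E} (hF : ∀ s, F s = F (s % K)) (g : ℕ → ℝ) (t : ℕ) :
    ∑ s ∈ Finset.range t, g s • F s = ∑ r : Fin K, phaseSum K r g t • F r := by
  simp only [phaseSum, Finset.sum_smul]
  rw [Finset.sum_comm]
  refine Finset.sum_congr rfl fun s _ => ?_
  rw [Finset.sum_eq_single (⟨s % K, Nat.mod_lt s hK⟩ : Fin K)]
  · simp [← hF]
  · intro b _ hb
    rw [if_neg, zero_smul]
    exact fun h => hb (Fin.ext h.symm)
  · simp

/-- The law of large numbers for gated sums of periodic summands of order `1 / t`. -/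
lemma IsDEDProcess.tendsto_integral_norm_gated_sum {E : Type*} [NormedAddCommGroup E]
    [NormedSpace ℝ E] (h : IsDEDProcess μ K D p Φ γ G Y) (hK : 0 < K) {F a : ℕ → ℕ → E}
    (hF : ∀ᶠ t in atTop, ∀ s, F t s = F t (s % K)) {C : ℝ} (ha : ∀ t (r : Fin K), ‖a t r‖ ≤ C)
    (hFa : ∀ r : Fin K, Tendsto (fun t : ℕ => (t : ℝ) • F t r - a t r) atTop (𝓝 0)) :
    Tendsto (fun t => ∫ x, ‖∑ s : Fin t, bit (x s).1 • F t s -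
      (1 / (K : ℝ)) • ∑ r : Fin K, γ r • a t r‖ ∂(obsLaw μ G Y t)) atTop (𝓝 0) := by
  have hbit : ∀ s, Measurable fun ω => bit (G s ω) := fun s =>
    (measurable_of_countable bit).comp (h.measurable_G s)
  have hbound : Tendsto (fun t : ℕ => ∑ r : Fin K, (‖(t : ℝ) • F t r - a t r‖ +
      (∫ ω, |phaseSum K r (fun s => bit (G s ω)) t / t - γ r / K| ∂μ) * C)) atTop (𝓝 0) := by
    have : ∀ r : Fin K, Tendsto (fun t : ℕ => ‖(t : ℝ) • F t r - a t r‖ +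
        (∫ ω, |phaseSum K r (fun s => bit (G s ω)) t / t - γ r / K| ∂μ) * C) atTop (𝓝 0) := by
      intro r
      simpa using (hFa r).norm.add ((h.tendsto_integral_phaseSum r).mul_const C)
    simpa using tendsto_finsetSum Finset.univ fun r _ => this r
  refine tendsto_of_tendsto_of_tendsto_of_le_of_le' tendsto_const_nhds hbound
    (Eventually.of_forall fun t => integral_nonneg fun _ => norm_nonneg _) ?_
  filter_upwards [hF, eventually_gt_atTop 0] with t hFt ht
  have ht0 : (0 : ℝ) < t := by exact_mod_cast ht
  have hpsm : ∀ r : Fin K, Measurable fun ω => phaseSum K r (fun s => bit (G s ω)) t := by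
    intro r
    refine Finset.measurable_sum _ fun s _ => ?_
    split_ifs
    · exact hbit s
    · exact measurable_const
  have hps : ∀ (r : Fin K) ω,
      phaseSum K r (fun s => bit (G s ω)) t / t ∈ Set.Icc (0 : ℝ) 1 := by
    intro r ω
    have := phaseSum_mem_Icc (K := K) (r := r) (fun s => bit_mem (G s ω)) t
    exact ⟨div_nonneg this.1 ht0.le, div_le_one_of_le₀ this.2 ht0.le⟩
  have hint : ∀ r : Fin K,
      Integrable (fun ω => |phaseSum K r (fun s => bit (G s ω)) t / t - γ r / K|) μ := by
    intro r
    refine Integrable.of_bound (((hpsm r).div_const _).sub_const _).abs.aestronglyMeasurable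
      (1 + |γ r / K|) (Eventually.of_forall fun ω => ?_)
    rw [Real.norm_eq_abs, abs_abs]
    refine (abs_sub _ _).trans ?_
    rw [abs_of_nonneg (hps r ω).1]
    linarith [(hps r ω).2]
  have hint' : ∀ r : Fin K, Integrable (fun ω => ‖(t : ℝ) • F t r - a t r‖ +
      |phaseSum K r (fun s => bit (G s ω)) t / t - γ r / K| * C) μ := fun r =>
    (integrable_const _).add ((hint r).mul_const C)
  rw [obsLaw, integral_map (h.measurable_obs t).aemeasurable
    (StronglyMeasurable.of_discrete).aestronglyMeasurable]
  calc _ ≤ ∫ ω, ∑ r : Fin K, (‖(t : ℝ) • F t r - a t r‖ +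
          |phaseSum K r (fun s => bit (G s ω)) t / t - γ r / K| * C) ∂μ := by
        refine integral_mono_of_nonneg (Eventually.of_forall fun _ => norm_nonneg _)
          (integrable_finsetSum _ fun r _ => hint' r)
          (Eventually.of_forall fun ω => ?_)
        change ‖∑ s : Fin t, bit (G s ω) • F t s - _‖ ≤ _
        rw [Fin.sum_univ_eq_sum_range (fun s => bit (G s ω) • F t s),
          sum_bit_smul_eq_sum_phaseSum hK hFt, Finset.smul_sum, ← Finset.sum_sub_distrib]
        refine (norm_sum_le _ _).trans (Finset.sum_le_sum fun r _ => ?_)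
        -- One error comes from replacing `t • F t r` by `a t r`, the other from replacing the
        -- empirical frequency by its limit. Boundedness of `a` suffices, which matters because the
        -- local directions `h_t` need not converge.
        have hdec : phaseSum K r (fun s => bit (G s ω)) t • F t r - (1 / (K : ℝ)) • γ r • a t r =
            (phaseSum K r (fun s => bit (G s ω)) t / t) • ((t : ℝ) • F t r - a t r) +
            (phaseSum K r (fun s => bit (G s ω)) t / t - γ r / K) • a t r := by
          rw [smul_sub, sub_smul, smul_smul, smul_smul, div_mul_cancel₀ _ ht0.ne',
            one_div_mul_eq_div]
          abel
        rw [hdec]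
        refine (norm_add_le _ _).trans (add_le_add ?_ ?_)
        · rw [norm_smul, Real.norm_eq_abs, abs_of_nonneg (hps r ω).1]
          exact mul_le_of_le_one_left (norm_nonneg _) (hps r ω).2
        · rw [norm_smul, Real.norm_eq_abs]
          exact mul_le_mul_of_nonneg_left (ha t r) (abs_nonneg _)
    _ = _ := by
        rw [integral_finsetSum _ fun r _ => hint' r]
        refine Finset.sum_congr rfl fun r _ => ?_
        rw [integral_add (integrable_const _) ((hint r).mul_const C), integral_mul_const]
        simp

end GatingAverage

end DED

namespace DED

/-! ### Taylor expansions of logarithms at scale `1 / √t`. -/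

section Asymptotics

lemma tendsto_of_isBigO_inv_sqrt {E : Type*} [NormedAddCommGroup E] {f : ℕ → E} {C : ℝ}
    (h : ∀ᶠ t : ℕ in atTop, ‖f t‖ ≤ C / √t) : Tendsto f atTop (𝓝 0) := by
  refine squeeze_zero_norm' h ?_
  exact (tendsto_const_nhds (x := C)).div_atTop
    (Real.tendsto_sqrt_atTop.comp tendsto_natCast_atTop_atTop)

/-- The logarithm series has remainder at most `|x| ^ 2 / (1 - |x|)`, and `1 - |x| ≥ 1 / 2`. -/
lemma abs_log_one_add_sub_le {x : ℝ} (hx : |x| ≤ 1 / 2) : |Real.log (1 + x) - x| ≤ 2 * |x| ^ 2 := by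
  have h := Real.abs_log_sub_add_sum_range_le (x := -x) (by rw [abs_neg]; linarith) 1
  simp only [Finset.sum_range_one, zero_add, pow_one, Nat.cast_zero, div_one, sub_neg_eq_add,
    abs_neg] at h
  rw [neg_add_eq_sub] at h
  refine h.trans ?_
  rw [div_le_iff₀ (by linarith)]
  have := mul_nonneg (pow_nonneg (abs_nonneg x) 2) (show 0 ≤ 1 - 2 * |x| by linarith)
  linear_combination this

lemma abs_log_one_add_sub_add_sq_le {x : ℝ} (hx : |x| ≤ 1 / 2) :
    |Real.log (1 + x) - x + x ^ 2 / 2| ≤ 2 * |x| ^ 3 := by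
  have h := Real.abs_log_sub_add_sum_range_le (x := -x) (by rw [abs_neg]; linarith) 2
  simp only [Finset.sum_range_succ, Finset.sum_range_zero, zero_add, pow_one, Nat.cast_zero,
    div_one, sub_neg_eq_add, abs_neg, Nat.cast_one] at h
  have e : -x + (-x) ^ (1 + 1) / (1 + 1) + Real.log (1 + x) =
      Real.log (1 + x) - x + x ^ 2 / 2 := by ring
  rw [e] at h
  refine h.trans ?_
  rw [div_le_iff₀ (by linarith)]
  have := mul_nonneg (pow_nonneg (abs_nonneg x) 3) (show 0 ≤ 1 - 2 * |x| by linarith)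
  linear_combination this

variable {x : ℕ → ℝ} {C : ℝ}

lemma tendsto_zero_of_abs_sqrt_mul_le (hx : ∀ᶠ t : ℕ in atTop, |√t * x t| ≤ C) :
    Tendsto x atTop (𝓝 0) := by
  refine tendsto_of_isBigO_inv_sqrt (C := C) ?_
  filter_upwards [hx, eventually_gt_atTop 0] with t ht ht0
  have hs : 0 < √(t : ℝ) := Real.sqrt_pos.2 (by exact_mod_cast ht0)
  rw [abs_mul, abs_of_pos hs] at ht
  rw [le_div_iff₀ hs, Real.norm_eq_abs]
  linarith

lemma eventually_abs_le_half (hx : ∀ᶠ t : ℕ in atTop, |√t * x t| ≤ C) :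
    ∀ᶠ t : ℕ in atTop, |x t| ≤ 1 / 2 := by
  have := (tendsto_zero_of_abs_sqrt_mul_le hx).abs
  rw [abs_zero] at this
  exact (this.eventually_lt_const (by norm_num : (0 : ℝ) < 1 / 2)).mono fun _ h => h.le

lemma tendsto_sqrt_mul_log_one_add_sub (hx : ∀ᶠ t : ℕ in atTop, |√t * x t| ≤ C) :
    Tendsto (fun t : ℕ => √t * (Real.log (1 + x t) - x t)) atTop (𝓝 0) := by
  refine tendsto_of_isBigO_inv_sqrt (C := 2 * C ^ 2) ?_
  filter_upwards [hx, eventually_abs_le_half hx, eventually_gt_atTop 0] with t ht ht2 ht0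
  have hs : 0 < √(t : ℝ) := Real.sqrt_pos.2 (by exact_mod_cast ht0)
  have h2 : (√(t : ℝ) * |x t|) ^ 2 ≤ C ^ 2 := by
    rw [abs_mul, abs_of_pos hs] at ht
    exact pow_le_pow_left₀ (by positivity) ht 2
  rw [le_div_iff₀ hs, Real.norm_eq_abs, abs_mul, abs_of_pos hs]
  calc _ ≤ √(t : ℝ) * (2 * |x t| ^ 2) * √(t : ℝ) := by
        gcongr
        exact abs_log_one_add_sub_le ht2
    _ = 2 * (√(t : ℝ) * |x t|) ^ 2 := by ring
    _ ≤ _ := by linarith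

lemma tendsto_mul_log_one_add_sub_add_sq (hx : ∀ᶠ t : ℕ in atTop, |√t * x t| ≤ C) :
    Tendsto (fun t : ℕ => (t : ℝ) * (Real.log (1 + x t) - x t + x t ^ 2 / 2)) atTop (𝓝 0) := by
  refine tendsto_of_isBigO_inv_sqrt (C := 2 * C ^ 3) ?_
  filter_upwards [hx, eventually_abs_le_half hx, eventually_gt_atTop 0] with t ht ht2 ht0
  have ht0' : (0 : ℝ) < t := by exact_mod_cast ht0
  have hs : 0 < √(t : ℝ) := Real.sqrt_pos.2 ht0'
  have hst : (t : ℝ) = √t ^ 2 := (Real.sq_sqrt ht0'.le).symm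
  have h2 : (√(t : ℝ) * |x t|) ^ 3 ≤ C ^ 3 := by
    rw [abs_mul, abs_of_pos hs] at ht
    exact pow_le_pow_left₀ (by positivity) ht 3
  rw [le_div_iff₀ hs, Real.norm_eq_abs, abs_mul, abs_of_pos ht0']
  calc _ ≤ t * (2 * |x t| ^ 3) * √(t : ℝ) := by
        gcongr
        exact abs_log_one_add_sub_add_sq_le ht2
    _ = √t ^ 2 * (2 * |x t| ^ 3) * √(t : ℝ) := by rw [← hst]
    _ = 2 * (√(t : ℝ) * |x t|) ^ 3 := by ring
    _ ≤ _ := by linarith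

/-- With `a = √t * y t`, this is `a² - c² = (a - c) ((a - c) + 2 c)`: a null sequence times a
bounded one. -/
lemma tendsto_mul_sq_of_bounded {y c : ℕ → ℝ} {B : ℝ} (hc : ∀ t, |c t| ≤ B)
    (h : Tendsto (fun t : ℕ => √t * y t - c t) atTop (𝓝 0)) :
    Tendsto (fun t : ℕ => (t : ℝ) * y t ^ 2 - c t ^ 2) atTop (𝓝 0) := by
  have h1 : Tendsto (fun t : ℕ => (√t * y t - c t) * ((√t * y t - c t) + 2 * c t)) atTop (𝓝 0) := by
    have hb : Tendsto (fun t : ℕ => (√t * y t - c t) * (2 * c t)) atTop (𝓝 0) := by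
      refine h.zero_mul_isBoundedUnder_le ?_
      refine isBoundedUnder_of ⟨2 * B, fun t => ?_⟩
      rw [Function.comp_apply, Real.norm_eq_abs, abs_mul, abs_two]
      linarith [hc t]
    have := (h.mul h).add hb
    simp only [mul_zero, add_zero] at this
    exact this.congr fun t => by ring
  refine h1.congr fun t => ?_
  have : (t : ℝ) = √t ^ 2 := (Real.sq_sqrt (Nat.cast_nonneg t)).symm
  conv_rhs => rw [this]
  ring

variable {q : ℝ} {y c : ℕ → ℝ} {B : ℝ}

lemma eventually_abs_sqrt_mul_le (hc : ∀ t, |c t| ≤ B)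
    (h : Tendsto (fun t : ℕ => √t * y t - c t) atTop (𝓝 0)) :
    ∀ᶠ t : ℕ in atTop, |√t * y t| ≤ B + 1 := by
  have := h.abs
  rw [abs_zero] at this
  filter_upwards [this.eventually_lt_const zero_lt_one] with t ht
  have := abs_sub_abs_le_abs_sub (√t * y t) (c t)
  linarith [hc t]

/-- First-order expansion of a log-likelihood ratio `log ((q + y) / q)`. -/
lemma tendsto_sqrt_mul_log_div (hq : q ≠ 0) (hc : ∀ t, |c t| ≤ B)
    (h : Tendsto (fun t : ℕ => √t * y t - c t) atTop (𝓝 0)) :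
    Tendsto (fun t : ℕ => √t * Real.log ((q + y t) / q) - c t / q) atTop (𝓝 0) := by
  have hb : ∀ᶠ t : ℕ in atTop, |√t * (y t / q)| ≤ (B + 1) / |q| := by
    filter_upwards [eventually_abs_sqrt_mul_le hc h] with t ht
    rw [← mul_div_assoc, abs_div]
    gcongr
  have := (tendsto_sqrt_mul_log_one_add_sub hb).add (h.div_const q)
  simp only [zero_div, add_zero] at this
  refine this.congr fun t => ?_
  rw [add_div, div_self hq]
  ring

/-- Second-order expansion of the Kullback-Leibler divergence of Bernoulli laws. -/
lemma tendsto_mul_bernoulli_log_mean (hq : q ∈ Set.Ioo (0 : ℝ) 1) (hc : ∀ t, |c t| ≤ B)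
    (h : Tendsto (fun t : ℕ => √t * y t - c t) atTop (𝓝 0)) :
    Tendsto (fun t : ℕ => (t : ℝ) * (q * Real.log ((q + y t) / q) +
      (1 - q) * Real.log ((1 - q - y t) / (1 - q))) + c t ^ 2 / (2 * (q * (1 - q)))) atTop (𝓝 0) := by
  have hq0 : q ≠ 0 := hq.1.ne'
  have hq1 : 1 - q ≠ 0 := (sub_pos.2 hq.2).ne'
  have hbd := eventually_abs_sqrt_mul_le hc h
  have hb1 : ∀ᶠ t : ℕ in atTop, |√t * (y t / q)| ≤ (B + 1) / |q| := by
    filter_upwards [hbd] with t ht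
    rw [← mul_div_assoc, abs_div]
    gcongr
  have hb2 : ∀ᶠ t : ℕ in atTop, |√t * (-y t / (1 - q))| ≤ (B + 1) / |1 - q| := by
    filter_upwards [hbd] with t ht
    rw [← mul_div_assoc, abs_div, mul_neg, abs_neg]
    gcongr
  -- In the weighted sum the linear terms `y` and `-y` cancel, and the quadratic ones add up to `-y²
  -- / (2 q (1 - q))`.
  have h1 := (tendsto_mul_log_one_add_sub_add_sq hb1).const_mul q
  have h2 := (tendsto_mul_log_one_add_sub_add_sq hb2).const_mul (1 - q)
  have h3 := (tendsto_mul_sq_of_bounded hc h).div_const (2 * (q * (1 - q)))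
  have := (h1.add h2).sub h3
  simp only [mul_zero, zero_div, sub_zero, add_zero] at this
  refine this.congr fun t => ?_
  have e1 : (q + y t) / q = 1 + y t / q := by field_simp
  have e2 : (1 - q - y t) / (1 - q) = 1 + -y t / (1 - q) := by field_simp; ring
  rw [e1, e2]
  field_simp
  ring

end Asymptotics

/-! ### Characteristic function of one active score term. -/

section CharFun

open Complex

/-- The remainder after the quadratic term is at most `|a|³ e^|a| / t^(3/2)`, so the factor `t`
leaves `O(1 / √t)`. -/
lemma tendsto_mul_cexp_sub_taylor (a : ℝ) :
    Tendsto (fun t : ℕ => (t : ℂ) * (cexp (((a / √t : ℝ) : ℂ) * I) -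
      (1 + ((a / √t : ℝ) : ℂ) * I - ((a ^ 2 / (2 * t) : ℝ) : ℂ)))) atTop (𝓝 0) := by
  refine tendsto_of_isBigO_inv_sqrt (C := |a| ^ 3 * Real.exp |a|) ?_
  filter_upwards [eventually_ge_atTop 1] with t ht
  have ht1 : (1 : ℝ) ≤ t := by exact_mod_cast ht
  have hs1 : 1 ≤ √(t : ℝ) := Real.one_le_sqrt.2 ht1
  have hs : 0 < √(t : ℝ) := by linarith
  have hst : √(t : ℝ) ^ 2 = t := Real.sq_sqrt (by linarith)
  have h := Complex.norm_exp_sub_sum_le_norm_mul_exp (((a / √t : ℝ) : ℂ) * I) 3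
  have e : ∑ m ∈ Finset.range 3, ((((a / √t : ℝ) : ℂ) * I) ^ m / (m.factorial : ℂ)) =
      1 + ((a / √t : ℝ) : ℂ) * I - ((a ^ 2 / (2 * t) : ℝ) : ℂ) := by
    have : a ^ 2 / (2 * t) = (a / √t) ^ 2 / 2 := by rw [div_pow, hst]; field_simp
    rw [this]
    simp only [Finset.sum_range_succ, Finset.sum_range_zero, mul_pow, I_sq]
    push_cast [Nat.factorial]
    ring
  rw [e] at h
  have hn : ‖((a / √t : ℝ) : ℂ) * I‖ = |a| / √t := by
    rw [norm_mul, norm_I, mul_one, norm_real, Real.norm_eq_abs, abs_div, abs_of_pos hs]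
  rw [hn] at h
  have hle : |a| / √t ≤ |a| := div_le_self (abs_nonneg a) hs1
  rw [norm_mul, norm_natCast, le_div_iff₀ hs]
  calc _ ≤ t * ((|a| / √t) ^ 3 * Real.exp |a|) * √t := by
        gcongr
        exact h.trans (by gcongr)
    _ = |a| ^ 3 * Real.exp |a| * (t / √t ^ 2) := by field_simp
    _ = |a| ^ 3 * Real.exp |a| := by rw [hst, div_self (by positivity), mul_one]
    _ ≤ _ := le_rfl

/-- The characteristic function at `c / √t` of the score of a Bernoulli observation. -/
noncomputable def scoreCharFun (q c : ℝ) (t : ℕ) : ℂ :=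
  q * cexp ((((1 - q) / q * c / √t : ℝ) : ℂ) * I) + (1 - q) * cexp (((-c / √t : ℝ) : ℂ) * I)

/-- The score is centred, so the linear terms cancel; its variance is `(1 - q) / q`. -/
lemma tendsto_mul_scoreCharFun_sub_one {q : ℝ} (hq : q ≠ 0) (c : ℝ) :
    Tendsto (fun t : ℕ => (t : ℂ) * (scoreCharFun q c t - 1)) atTop
      (𝓝 ((-((1 - q) / q * c ^ 2 / 2) : ℝ) : ℂ)) := by
  have h1 := (tendsto_mul_cexp_sub_taylor ((1 - q) / q * c)).const_mul (q : ℂ)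
  have h2 := (tendsto_mul_cexp_sub_taylor (-c)).const_mul (1 - (q : ℂ))
  have h := (h1.add h2).add_const ((-((1 - q) / q * c ^ 2 / 2) : ℝ) : ℂ)
  simp only [mul_zero, zero_add] at h
  refine h.congr' ?_
  filter_upwards [eventually_gt_atTop 0] with t ht
  have ht0 : (t : ℂ) ≠ 0 := by exact_mod_cast ht.ne'
  have hs0 : ((√(t : ℝ) : ℝ) : ℂ) ≠ 0 := by
    exact_mod_cast (Real.sqrt_pos.2 (by exact_mod_cast ht)).ne'
  have hq' : (q : ℂ) ≠ 0 := by exact_mod_cast hq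
  rw [scoreCharFun]
  push_cast
  field_simp
  ring

/-- The characteristic function tends to `1`, so it is eventually nonzero and its logarithm can be
exponentiated back. -/
lemma eventually_exp_log_scoreCharFun {q : ℝ} (hq : q ≠ 0) (c : ℝ) :
    ∀ᶠ t in atTop, cexp (Complex.log (scoreCharFun q c t)) = scoreCharFun q c t := by
  have h := tendsto_mul_scoreCharFun_sub_one hq c
  have h1 : Tendsto (fun t : ℕ => (t : ℂ)⁻¹ * ((t : ℂ) * (scoreCharFun q c t - 1))) atTop (𝓝 0) := by
    simpa using (tendsto_inv_atTop_nhds_zero_nat (𝕜 := ℂ)).mul h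
  have h2 : Tendsto (scoreCharFun q c) atTop (𝓝 1) := by
    have := h1.add_const 1
    rw [zero_add] at this
    refine this.congr' ?_
    filter_upwards [eventually_gt_atTop 0] with t ht
    have ht0 : (t : ℂ) ≠ 0 := by exact_mod_cast ht.ne'
    rw [inv_mul_cancel_left₀ ht0]
    ring
  filter_upwards [h2.eventually_ne one_ne_zero] with t ht using Complex.exp_log ht

lemma tendsto_mul_log_scoreCharFun {q : ℝ} (hq : q ≠ 0) (c : ℝ) :
    Tendsto (fun t : ℕ => (t : ℂ) * Complex.log (scoreCharFun q c t)) atTop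
      (𝓝 ((-((1 - q) / q * c ^ 2 / 2) : ℝ) : ℂ)) := by
  have := Complex.tendsto_nat_mul_log_one_add_of_tendsto (tendsto_mul_scoreCharFun_sub_one hq c)
  simpa using this

end CharFun

end DED

namespace DED

/-! ### The quadratic expansion of the log-likelihood ratio. -/

section Expansion

variable {Φ : (t : ℕ) → (Fin t → Bool × Bool) → unitInterval → Bool}
  {Ω : Type*} [MeasurableSpace Ω] {μ : Measure Ω} [IsProbabilityMeasure μ] {K D : ℕ}
  {q : ℕ → ℝ} {γ : Fin K → ℝ} {G Y : ℕ → Ω → Bool}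

/-- The score of one observation `x` with respect to the event rate. -/
noncomputable def rateScore (q : ℝ) (x : Bool × Bool) : ℝ := bit x.1 * ((bit x.2 - q) / q)

/-- A law of large numbers for sums of conditionally centred increments. -/
lemma IsDEDProcess.isLittleOInProb_sum_centred (h : IsDEDProcess μ K D q Φ γ G Y)
    (hΦ : ∀ t, Measurable (Function.uncurry (Φ t))) (hq : ∀ s, q s ∈ Set.Ioo (0 : ℝ) 1)
    {w : ℕ → ℕ → Bool × Bool → ℝ} {e : ℕ → ℝ}
    (hw : ∀ t s g, ∑ b, eventWeight (q s) (g, b) * w t s (g, b) = 0)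
    (he : ∀ᶠ t in atTop, ∀ s g, ∑ b, eventWeight (q s) (g, b) * w t s (g, b) ^ 2 ≤ e t)
    (hlim : Tendsto (fun t : ℕ => (t : ℝ) * e t) atTop (𝓝 0)) :
    IsLittleOInProb (fun t => obsLaw μ G Y t) (fun t x => ∑ s : Fin t, w t s (x s)) := by
  have := h.isProbabilityMeasure_obsLaw
  refine IsLittleOInProb.of_tendsto_integral 2 ?_
  refine tendsto_of_tendsto_of_tendsto_of_le_of_le' tendsto_const_nhds hlim
    (Eventually.of_forall fun t => integral_nonneg fun _ => by positivity) ?_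
  filter_upwards [he] with t ht
  rw [h.integral_obsLaw hΦ]
  simp only [sq_abs, smul_eq_mul]
  exact sum_gateWeight_mul_sq_le hΦ (fun s => eventWeight (q s)) (w t)
    (fun s => eventWeight_nonneg ⟨(hq s).1.le, (hq s).2.le⟩) (fun s => sum_eventWeight (q s))
    (hw t) ht t

/-- The mean of the log-likelihood ratio of an observation in the active state. -/
noncomputable def meanLogRatio (q q' : ℝ) : ℝ :=
  q * Real.log (q' / q) + (1 - q) * Real.log ((1 - q') / (1 - q))

/-- The score has conditional mean zero, and `meanLogRatio` is the conditional mean of the log ratio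
when the gate is open. When it is closed all terms of positive weight vanish. -/
lemma sum_eventWeight_mul_logRatio_sub {q : ℝ} (hq : q ≠ 0) (q' c : ℝ) (g : Bool) :
    ∑ b, eventWeight q (g, b) * (Real.log (eventWeight q' (g, b) / eventWeight q (g, b)) -
      rateScore q (g, b) * c - bit g * meanLogRatio q q') = 0 := by
  cases g
  · simp [eventWeight, rateScore, bit]
  · simp [eventWeight, rateScore, bit, meanLogRatio]
    field_simp
    ring

/-- A variance is at most a second moment: `meanLogRatio` is also the mean of the two deviations
squared on the right, since the score terms average out. -/
lemma sum_eventWeight_mul_logRatio_sub_sq_le {q : ℝ} (hq : q ∈ Set.Ioo (0 : ℝ) 1) (q' c : ℝ)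
    (g : Bool) :
    ∑ b, eventWeight q (g, b) * (Real.log (eventWeight q' (g, b) / eventWeight q (g, b)) -
      rateScore q (g, b) * c - bit g * meanLogRatio q q') ^ 2 ≤
      (Real.log (q' / q) - (1 - q) / q * c) ^ 2 + (Real.log ((1 - q') / (1 - q)) + c) ^ 2 := by
  have hq0 := hq.1.ne'
  cases g
  · simp [eventWeight, rateScore, bit]
    positivity
  · have hm : meanLogRatio q q' = q * (Real.log (q' / q) - (1 - q) / q * c) +
        (1 - q) * (Real.log ((1 - q') / (1 - q)) + c) := by
      rw [meanLogRatio]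
      field_simp
      ring
    have hc : -q / q * c = -c := by field_simp
    simp only [Fintype.sum_bool, eventWeight, rateScore, bit, if_true, one_mul, zero_sub,
      Bool.false_eq_true, if_false, hc, sub_neg_eq_add, hm]
    set A := Real.log (q' / q) - (1 - q) / q * c
    set B := Real.log ((1 - q') / (1 - q)) + c
    have h1 : 0 ≤ (1 - q) * A ^ 2 := mul_nonneg (sub_nonneg.2 hq.2.le) (sq_nonneg A)
    have h2 : 0 ≤ q * B ^ 2 := mul_nonneg hq.1.le (sq_nonneg B)
    have h3 := sq_nonneg (q * A + (1 - q) * B)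
    linear_combination h1 + h2 + h3

/-- Local asymptotic normality of the log-likelihood ratio, written as a sum over the
observations. -/
theorem IsDEDProcess.isLittleOInProb_logRatio (h : IsDEDProcess μ K D q Φ γ G Y) (hK : 0 < K)
    (hΦ : ∀ t, Measurable (Function.uncurry (Φ t))) (hq : ∀ s, q s ∈ Set.Ioo (0 : ℝ) 1)
    (hqK : ∀ s, q s = q (s % K)) {q' c : ℕ → ℕ → ℝ}
    (hq'K : ∀ᶠ t in atTop, ∀ s, q' t s = q' t (s % K)) (hcK : ∀ t s, c t s = c t (s % K))
    {B : ℝ} (hB : ∀ t s, |c t s| ≤ B)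
    (hlim : ∀ r : Fin K, Tendsto (fun t : ℕ => √t * (q' t r - q r) - (1 - q r) * c t r) atTop
      (𝓝 0)) :
    IsLittleOInProb (fun t => obsLaw μ G Y t) (fun t x =>
      ∑ s : Fin t, Real.log (eventWeight (q' t s) (x s) / eventWeight (q s) (x s)) -
        ((∑ s : Fin t, rateScore (q s) (x s) * (c t s / √t)) -
          1 / 2 * ((1 / (K : ℝ)) * ∑ r : Fin K, γ r * ((1 - q r) / q r * c t r ^ 2)))) := by
  have := h.isProbabilityMeasure_obsLaw
  have hB0 : 0 ≤ B := (abs_nonneg _).trans (hB 0 0)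
  have hcb : ∀ (r : Fin K) t, |(1 - q r) * c t r| ≤ B := by
    intro r t
    rw [abs_mul, abs_of_pos (sub_pos.2 (hq r).2)]
    exact (mul_le_of_le_one_left (abs_nonneg _) (by linarith [(hq r).1])).trans (hB t r)
  -- `w` is the conditionally centred remainder after removal of the score and the gated mean; `e`
  -- bounds its conditional variance.
  set w : ℕ → ℕ → Bool × Bool → ℝ := fun t s x =>
    Real.log (eventWeight (q' t s) x / eventWeight (q s) x) - rateScore (q s) x * (c t s / √t) -
      bit x.1 * meanLogRatio (q s) (q' t s)
  set e : ℕ → ℕ → ℝ := fun t s =>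
    (Real.log (q' t s / q s) - (1 - q s) / q s * (c t s / √t)) ^ 2 +
      (Real.log ((1 - q' t s) / (1 - q s)) + c t s / √t) ^ 2
  have hscale : ∀ {f : ℕ → ℝ}, Tendsto (fun t : ℕ => √t * f t) atTop (𝓝 0) →
      Tendsto (fun t : ℕ => (t : ℝ) * f t ^ 2) atTop (𝓝 0) := by
    intro f hf
    have h2 := hf.pow 2
    rw [zero_pow two_ne_zero] at h2
    exact h2.congr fun t => by rw [mul_pow, Real.sq_sqrt (Nat.cast_nonneg t)]
  have hsqrt : ∀ᶠ t : ℕ in atTop, √(t : ℝ) ≠ 0 := by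
    filter_upwards [eventually_gt_atTop 0] with t ht
    exact (Real.sqrt_pos.2 (by exact_mod_cast ht)).ne'
  -- Both deviations in `e` are `o(1 / √t)`: the score term is the first-order part of the log ratio
  -- for either outcome.
  have he : ∀ r : Fin K, Tendsto (fun t : ℕ => (t : ℝ) * e t r) atTop (𝓝 0) := by
    intro r
    have hq0 := (hq r).1.ne'
    have hq1 : 1 - q r ≠ 0 := (sub_pos.2 (hq r).2).ne'
    have h1 := tendsto_sqrt_mul_log_div hq0 (hcb r) (hlim r)
    have h2 := tendsto_sqrt_mul_log_div (q := 1 - q r) (y := fun t => -(q' t r - q r))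
      (c := fun t => -((1 - q r) * c t r)) (B := B) hq1 (fun t => by rw [abs_neg]; exact hcb r t)
      (by
        have := (hlim r).neg
        rw [neg_zero] at this
        exact this.congr fun t => by ring)
    have h1' : Tendsto (fun t : ℕ => √t *
        (Real.log (q' t r / q r) - (1 - q r) / q r * (c t r / √t))) atTop (𝓝 0) := by
      refine h1.congr' ?_
      filter_upwards [hsqrt] with t ht
      rw [add_sub_cancel]
      field_simp
    have h2' : Tendsto (fun t : ℕ => √t *
        (Real.log ((1 - q' t r) / (1 - q r)) + c t r / √t)) atTop (𝓝 0) := by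
      refine h2.congr' ?_
      filter_upwards [hsqrt] with t ht
      rw [show 1 - q r + -(q' t r - q r) = 1 - q' t r by ring]
      field_simp
      ring
    have := (hscale h1').add (hscale h2')
    rw [add_zero] at this
    exact this.congr fun t => by simp only [e]; ring
  have hpart1 : IsLittleOInProb (fun t => obsLaw μ G Y t)
      (fun t x => ∑ s : Fin t, w t s (x s)) := by
    refine h.isLittleOInProb_sum_centred hΦ hq (e := fun t => ∑ r : Fin K, e t r)
      (fun t s g => sum_eventWeight_mul_logRatio_sub (hq s).1.ne' _ _ g) ?_ ?_
    · filter_upwards [hq'K] with t ht s g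
      refine (sum_eventWeight_mul_logRatio_sub_sq_le (hq s) (q' t s) (c t s / √t) g).trans ?_
      have hes : e t s = e t (s % K) := by
        simp only [e]
        rw [hqK s, ht s, hcK t s]
      change e t s ≤ _
      rw [hes]
      exact Finset.single_le_sum (f := fun r : Fin K => e t r)
        (fun r _ => add_nonneg (sq_nonneg _) (sq_nonneg _))
        (Finset.mem_univ (⟨s % K, Nat.mod_lt s hK⟩ : Fin K))
    · have := tendsto_finsetSum Finset.univ fun r _ => he r
      simp only [Finset.sum_const_zero] at this
      exact this.congr fun t => by rw [Finset.mul_sum]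
  -- The gated means are minus Kullback-Leibler divergences, of order `1 / t`, so the law of large
  -- numbers applies with their limiting second-order coefficients.
  have hpart2 : IsLittleOInProb (fun t => obsLaw μ G Y t)
      (fun t x => ∑ s : Fin t, bit (x s).1 • meanLogRatio (q s) (q' t s) -
        (1 / (K : ℝ)) • ∑ r : Fin K, γ r • (-((1 - q r) / q r * c t r ^ 2 / 2))) := by
    refine IsLittleOInProb.of_tendsto_integral 1 ?_
    simp only [pow_one]
    refine h.tendsto_integral_norm_gated_sum hK
      (F := fun t s => meanLogRatio (q s) (q' t s))
      (a := fun t s => -((1 - q s) / q s * c t s ^ 2 / 2))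
      (C := (∑ r : Fin K, |(1 - q r) / q r|) * B ^ 2) ?_ ?_ ?_
    · filter_upwards [hq'K] with t ht s
      rw [hqK s, ht s]
    · intro t r
      have h1 : |(1 - q r) / q r| ≤ ∑ r : Fin K, |(1 - q r) / q r| :=
        Finset.single_le_sum (f := fun r : Fin K => |(1 - q r) / q r|)
          (fun r _ => abs_nonneg _) (Finset.mem_univ r)
      have h2 : |c t r| ^ 2 ≤ B ^ 2 := pow_le_pow_left₀ (abs_nonneg _) (hB t r) 2
      rw [Real.norm_eq_abs, abs_neg, abs_div, abs_mul, abs_pow, abs_two]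
      have h3 : |(1 - q r) / q r| * |c t r| ^ 2 ≤ (∑ r : Fin K, |(1 - q r) / q r|) * B ^ 2 := by
        gcongr
      have h4 : 0 ≤ |(1 - q r) / q r| * |c t r| ^ 2 := by positivity
      linarith
    · intro r
      have hq0 := (hq r).1.ne'
      have hq1 : 1 - q r ≠ 0 := (sub_pos.2 (hq r).2).ne'
      refine (tendsto_mul_bernoulli_log_mean (hq r) (hcb r) (hlim r)).congr fun t => ?_
      rw [add_sub_cancel, show 1 - q r - (q' t r - q r) = 1 - q' t r by ring, meanLogRatio,
        smul_eq_mul, sub_neg_eq_add]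
      congr 1
      field_simp
  refine (hpart1.add hpart2).congr (Eventually.of_forall fun t => Eventually.of_forall fun x => ?_)
  simp only [w, Finset.sum_sub_distrib, smul_eq_mul]
  have : ∑ r : Fin K, γ r * (-((1 - q r) / q r * c t r ^ 2 / 2)) =
      -(1 / 2) * ∑ r : Fin K, γ r * ((1 - q r) / q r * c t r ^ 2) := by
    rw [Finset.mul_sum]
    exact Finset.sum_congr rfl fun r _ => by ring
  rw [this]
  ring

end Expansion

/-! ### Central limit theorem by multiplicative compensation. -/

section CentralLimit

open Complex

variable {Φ : (t : ℕ) → (Fin t → Bool × Bool) → unitInterval → Bool}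
  {Ω : Type*} [MeasurableSpace Ω] {μ : Measure Ω} [IsProbabilityMeasure μ] {K D : ℕ}
  {q : ℕ → ℝ} {γ : Fin K → ℝ} {G Y : ℕ → Ω → Bool}

/-- Dividing by the conditional characteristic function normalizes each factor. With the gate closed
the score is zero and the factor `bit g` switches the compensator off. -/
lemma sum_eventWeight_mul_cexp_rateScore {q : ℝ} (hq : q ≠ 0) (c : ℝ) {t : ℕ}
    (ht : cexp (Complex.log (scoreCharFun q c t)) = scoreCharFun q c t) (g : Bool) :
    ∑ b, (eventWeight q (g, b) : ℂ) * cexp (((rateScore q (g, b) * (c / √t) : ℝ) : ℂ) * I -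
      bit g • Complex.log (scoreCharFun q c t)) = 1 := by
  cases g
  · simp [eventWeight, rateScore, bit]
  · have h1 : scoreCharFun q c t * cexp (-Complex.log (scoreCharFun q c t)) = 1 := by
      nth_rewrite 1 [← ht]
      rw [← Complex.exp_add, add_neg_cancel, Complex.exp_zero]
    have e1 : rateScore q (true, true) * (c / √t) = (1 - q) / q * c / √t := by
      simp [rateScore, bit]
      ring
    have e0 : rateScore q (true, false) * (c / √t) = -c / √t := by
      simp [rateScore, bit]
      field_simp
    have hsplit : ∀ z w : ℂ, cexp (z - w) = cexp z * cexp (-w) := fun z w => by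
      rw [sub_eq_add_neg, Complex.exp_add]
    rw [Fintype.sum_bool, e1, e0, hsplit, hsplit]
    refine Eq.trans ?_ h1
    rw [scoreCharFun]
    simp only [eventWeight, bit, if_true, one_smul, Bool.false_eq_true, if_false]
    push_cast
    ring

/-- A bound uniform in the observations, which keeps the random compensator bounded. -/
lemma norm_gated_sum_le {E : Type*} [NormedAddCommGroup E] [NormedSpace ℝ E] (hK : 0 < K)
    {F : ℕ → E} (hF : ∀ s, F s = F (s % K)) (t : ℕ) (x : Fin t → Bool × Bool) :
    ‖∑ s : Fin t, bit (x s).1 • F s‖ ≤ ∑ r : Fin K, (t : ℝ) * ‖F r‖ := by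
  have hterm : ∀ s : Fin t, ‖bit (x s).1 • F s‖ ≤ ∑ r : Fin K, ‖F r‖ := by
    intro s
    rw [norm_smul, Real.norm_eq_abs, abs_of_nonneg (bit_mem _).1, hF s]
    refine (mul_le_of_le_one_left (norm_nonneg _) (bit_mem _).2).trans ?_
    exact Finset.single_le_sum (f := fun r : Fin K => ‖F r‖)
      (fun r _ => norm_nonneg _) (Finset.mem_univ (⟨s % K, Nat.mod_lt s hK⟩ : Fin K))
  calc _ ≤ ∑ s : Fin t, ‖bit (x s).1 • F s‖ := norm_sum_le _ _
    _ ≤ ∑ s : Fin t, ∑ r : Fin K, ‖F r‖ := Finset.sum_le_sum fun s _ => hterm s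
    _ = ∑ r : Fin K, (t : ℝ) * ‖F r‖ := by
      rw [Finset.sum_const, Finset.card_univ, Fintype.card_fin, nsmul_eq_mul, Finset.mul_sum]

/-- The characteristic function of a normalized sum of scores converges to that of a Gaussian
law. -/
theorem IsDEDProcess.tendsto_integral_cexp_score (h : IsDEDProcess μ K D q Φ γ G Y) (hK : 0 < K)
    (hΦ : ∀ t, Measurable (Function.uncurry (Φ t))) (hq : ∀ s, q s ∈ Set.Ioo (0 : ℝ) 1)
    (hqK : ∀ s, q s = q (s % K)) {c : ℕ → ℝ} (hcK : ∀ s, c s = c (s % K)) :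
    Tendsto (fun t : ℕ => ∫ x, cexp (((∑ s : Fin t, rateScore (q s) (x s) * (c s / √t) : ℝ) : ℂ) * I)
      ∂(obsLaw μ G Y t)) atTop
      (𝓝 (cexp ((-(1 / 2 * ((1 / (K : ℝ)) *
        ∑ r : Fin K, γ r * ((1 - q r) / q r * c r ^ 2))) : ℝ) : ℂ))) := by
  have := h.isProbabilityMeasure_obsLaw
  set ℓ : ℂ := (1 / (K : ℝ)) • ∑ r : Fin K, γ r • ((-((1 - q r) / q r * c r ^ 2 / 2) : ℝ) : ℂ)
    with hℓ
  have hℓ' : ((-(1 / 2 * ((1 / (K : ℝ)) *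
      ∑ r : Fin K, γ r * ((1 - q r) / q r * c r ^ 2))) : ℝ) : ℂ) = ℓ := by
    rw [hℓ]
    simp only [Complex.real_smul]
    push_cast
    rw [mul_left_comm, ← mul_neg, Finset.mul_sum, ← Finset.sum_neg_distrib]
    congr 1
    exact Finset.sum_congr rfl fun r _ => by ring
  rw [hℓ']
  set lφ : ℕ → ℕ → ℂ := fun t s => Complex.log (scoreCharFun (q s) (c s) t)
  have hlφK : ∀ t s, lφ t s = lφ t (s % K) := by
    intro t s
    simp only [lφ]
    rw [hqK s, hcK s]
  -- The log-compensator is random only through the gates, so the gating law of large numbers gives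
  -- its limit `ℓ`.
  set V : (t : ℕ) → (Fin t → Bool × Bool) → ℂ := fun t x => ∑ s : Fin t, bit (x s).1 • lφ t s
  have hlim : ∀ r : Fin K, Tendsto (fun t : ℕ => (t : ℂ) * lφ t r) atTop
      (𝓝 ((-((1 - q r) / q r * c r ^ 2 / 2) : ℝ) : ℂ)) := fun r =>
    tendsto_mul_log_scoreCharFun (hq r).1.ne' (c r)
  have hV : Tendsto (fun t => ∫ x, ‖V t x - ℓ‖ ∂(obsLaw μ G Y t)) atTop (𝓝 0) := by
    refine h.tendsto_integral_norm_gated_sum hK (F := lφ)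
      (a := fun _ s => ((-((1 - q s) / q s * c s ^ 2 / 2) : ℝ) : ℂ))
      (C := ∑ r : Fin K, ‖((-((1 - q r) / q r * c r ^ 2 / 2) : ℝ) : ℂ)‖)
      (Eventually.of_forall fun t s => hlφK t s) ?_ ?_
    · exact fun t r => Finset.single_le_sum
        (f := fun r : Fin K => ‖((-((1 - q r) / q r * c r ^ 2 / 2) : ℝ) : ℂ)‖)
        (fun r _ => norm_nonneg _) (Finset.mem_univ r)
    · intro r
      have := (hlim r).sub_const ((-((1 - q r) / q r * c r ^ 2 / 2) : ℝ) : ℂ)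
      rw [sub_self] at this
      exact this.congr fun t => by rw [Complex.real_smul]; push_cast; rfl
  obtain ⟨M, hM⟩ : ∃ M : ℝ, ∀ᶠ t in atTop, ∀ x, ‖V t x - ℓ‖ ≤ M := by
    have hsum : Tendsto (fun t : ℕ => ∑ r : Fin K, ‖(t : ℂ) * lφ t r‖) atTop
        (𝓝 (∑ r : Fin K, ‖((-((1 - q r) / q r * c r ^ 2 / 2) : ℝ) : ℂ)‖)) :=
      tendsto_finsetSum _ fun r _ => (hlim r).norm
    refine ⟨(∑ r : Fin K, ‖((-((1 - q r) / q r * c r ^ 2 / 2) : ℝ) : ℂ)‖) + 1 + ‖ℓ‖, ?_⟩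
    filter_upwards [hsum.eventually_lt_const (lt_add_one _)] with t ht x
    refine (norm_sub_le _ _).trans (add_le_add ?_ le_rfl)
    refine le_trans ?_ ht.le
    refine (norm_gated_sum_le hK (hlφK t) t x).trans (le_of_eq ?_)
    exact Finset.sum_congr rfl fun r _ => by rw [norm_mul, norm_natCast]
  have hexp : ∀ᶠ t in atTop, ∀ s, cexp (lφ t s) = scoreCharFun (q s) (c s) t := by
    have : ∀ᶠ t in atTop, ∀ r : Fin K, cexp (lφ t r) = scoreCharFun (q r) (c r) t :=
      eventually_all.2 fun r => eventually_exp_log_scoreCharFun (hq r).1.ne' (c r)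
    filter_upwards [this] with t ht s
    rw [hlφK, hqK s, hcK s]
    exact ht ⟨s % K, Nat.mod_lt s hK⟩
  rw [tendsto_iff_norm_sub_tendsto_zero]
  refine tendsto_of_tendsto_of_tendsto_of_le_of_le' tendsto_const_nhds
    (by simpa using hV.mul_const (Real.exp M)) (Eventually.of_forall fun _ => norm_nonneg _) ?_
  filter_upwards [hM, hexp] with t hMt hexpt
  set S : (Fin t → Bool × Bool) → ℝ := fun x => ∑ s : Fin t, rateScore (q s) (x s) * (c s / √t)
  -- The compensated exponential is a product of conditionally normalized complex weights.
  have hone : ∫ x, cexp ((S x : ℂ) * I - V t x) ∂(obsLaw μ G Y t) = 1 := by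
    rw [h.integral_obsLaw hΦ]
    have := sum_gateWeight_mul_prod_eq_one (𝕜 := ℂ) hΦ
      (fun s x => (eventWeight (q s) x : ℂ) *
        cexp (((rateScore (q s) x * (c s / √t) : ℝ) : ℂ) * I - bit x.1 • lφ t s))
      (fun s g => sum_eventWeight_mul_cexp_rateScore (hq s).1.ne' (c s) (hexpt s) g) t
    refine Eq.trans (Finset.sum_congr rfl fun x _ => ?_) this
    rw [Finset.prod_mul_distrib, ← Complex.exp_sum, Finset.sum_sub_distrib, ← Finset.sum_mul,
      Complex.real_smul]
    simp only [S, V]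
    push_cast
    exact mul_assoc _ _ _
  -- Because the compensated exponential has mean one, `cexp ℓ` can be put under the integral. The
  -- error is then controlled by `|V - ℓ|`, since `|exp (iS)| = 1` and `V - ℓ` is bounded by `M`.
  have hdiff : ∫ x, cexp ((S x : ℂ) * I) ∂(obsLaw μ G Y t) - cexp ℓ =
      ∫ x, cexp ((S x : ℂ) * I) * (1 - cexp (ℓ - V t x)) ∂(obsLaw μ G Y t) := by
    have h2 : cexp ℓ = ∫ x, cexp ℓ * cexp ((S x : ℂ) * I - V t x) ∂(obsLaw μ G Y t) := by
      rw [integral_const_mul, hone, mul_one]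
    rw [h2, ← integral_sub Integrable.of_finite Integrable.of_finite]
    refine integral_congr_ae (Eventually.of_forall fun x => ?_)
    change _ - _ = _ * _
    rw [mul_sub, mul_one, ← Complex.exp_add, ← Complex.exp_add]
    congr 2
    ring
  rw [hdiff]
  calc _ ≤ ∫ x, ‖cexp ((S x : ℂ) * I) * (1 - cexp (ℓ - V t x))‖ ∂(obsLaw μ G Y t) :=
        norm_integral_le_integral_norm _
    _ ≤ ∫ x, ‖V t x - ℓ‖ * Real.exp M ∂(obsLaw μ G Y t) := by
        refine integral_mono Integrable.of_finite Integrable.of_finite fun x => ?_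
        change ‖_‖ ≤ _
        rw [norm_mul, Complex.norm_exp_ofReal_mul_I, one_mul, norm_sub_rev]
        have := Complex.norm_exp_sub_sum_le_norm_mul_exp (ℓ - V t x) 1
        simp only [Finset.sum_range_one, pow_zero, Nat.factorial_zero, Nat.cast_one, div_one,
          pow_one, norm_sub_rev ℓ] at this
        refine this.trans ?_
        gcongr
        exact hMt x
    _ = _ := integral_mul_const _ _

end CentralLimit

end DED

namespace DED

/-! ### From regularity of the rates to local behaviour of the event probabilities. -/

section Model

variable {d K D : ℕ} {Θ : Set (Param d)} {p : Param d → ℕ → ℝ}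
  {Φ : (t : ℕ) → (Fin t → Bool × Bool) → unitInterval → Bool} {γ : Param d → Fin K → ℝ}
  {Ω : Param d → Type*} [∀ θ, MeasurableSpace (Ω θ)] {P : (θ : Param d) → Measure (Ω θ)}
  {G Y : (θ : Param d) → ℕ → Ω θ → Bool} {θ₀ : Param d}

lemma IsDEDModel.p_mod (hmodel : IsDEDModel Θ K D p Φ γ P G Y) {θ : Param d} (hθ : θ ∈ Θ) (s : ℕ) :
    p θ s = p θ (s % K) :=
  ((show Function.Periodic (p θ) K from hmodel.p_periodic θ hθ).map_mod_nat s).symm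

lemma eventRate_toReal {q : ℝ} (h0 : 0 ≤ q) (h1 : q < 1) :
    (eventRate q).toReal = -Real.log (1 - q) := by
  rw [eventRate, if_pos h1, ENNReal.toReal_ofReal]
  exact neg_nonneg.2 (Real.log_nonpos (by linarith) (by linarith))

lemma mem_Icc_of_eventRate_bounds {q lmin lmax : ℝ} (hq : q ∈ Set.Icc (0 : ℝ) 1) (hmin : 0 < lmin)
    (h1 : ENNReal.ofReal lmin ≤ eventRate q) (h2 : eventRate q ≤ ENNReal.ofReal lmax) :
    q < 1 ∧ 1 - Real.exp (-lmin) ≤ q ∧ q ≤ 1 - Real.exp (-lmax) := by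
  have hq1 : q < 1 := by
    by_contra hcon
    rw [eventRate, if_neg hcon] at h2
    exact absurd h2 (not_le.2 ENNReal.ofReal_lt_top)
  have hr0 : 0 ≤ -Real.log (1 - q) :=
    neg_nonneg.2 (Real.log_nonpos (by linarith) (by linarith [hq.1]))
  rw [eventRate, if_pos hq1] at h1 h2
  have h1' : lmin ≤ -Real.log (1 - q) := (ENNReal.ofReal_le_ofReal_iff hr0).1 h1
  have h2' : -Real.log (1 - q) ≤ lmax := by
    rcases le_or_gt 0 lmax with hl | hl
    · exact (ENNReal.ofReal_le_ofReal_iff hl).1 h2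
    -- A negative `lmax` is truncated to rate zero, which contradicts `0 < lmin`.
    · rw [ENNReal.ofReal_of_nonpos hl.le, nonpos_iff_eq_zero, ENNReal.ofReal_eq_zero] at h2
      linarith
  have hpos : 0 < 1 - q := by linarith
  refine ⟨hq1, ?_, ?_⟩
  · have : Real.log (1 - q) ≤ -lmin := by linarith
    linarith [(Real.log_le_iff_le_exp hpos).1 this]
  · have : -lmax ≤ Real.log (1 - q) := by linarith
    linarith [(Real.le_log_iff_exp_le hpos).1 this]

lemma IsDEDModel.exists_bounds (hmodel : IsDEDModel Θ K D p Φ γ P G Y)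
    (hreg : RegularAt Θ p γ θ₀) : ∃ a b : ℝ, 0 < a ∧ 0 < b ∧ ∀ θ ∈ Θ, ∀ s, a ≤ p θ s ∧
      b ≤ 1 - p θ s := by
  obtain ⟨lmin, lmax, h0, -, hb⟩ := hreg.rate_bounds
  refine ⟨1 - Real.exp (-lmin), Real.exp (-lmax), ?_, Real.exp_pos _, fun θ hθ s => ?_⟩
  · rw [sub_pos, Real.exp_lt_one_iff]
    linarith
  · have h := hb ⟨s % K, Nat.mod_lt s hmodel.period_pos⟩ θ hθ
    rw [hmodel.p_mod hθ s]
    have := mem_Icc_of_eventRate_bounds (hmodel.p_mem θ hθ _) h0 h.1 h.2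
    exact ⟨this.2.1, by linarith [this.2.2]⟩

lemma IsDEDModel.p_mem_Ioo (hmodel : IsDEDModel Θ K D p Φ γ P G Y)
    (hreg : RegularAt Θ p γ θ₀) {θ : Param d} (hθ : θ ∈ Θ) (s : ℕ) :
    p θ s ∈ Set.Ioo (0 : ℝ) 1 := by
  obtain ⟨a, b, ha, hb, h⟩ := hmodel.exists_bounds hreg
  have := h θ hθ s
  exact ⟨by linarith [this.1], by linarith [this.2]⟩

lemma RegularAt.mem (hreg : RegularAt Θ p γ θ₀) : θ₀ ∈ Θ := interior_subset hreg.mem_interior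

/-- At an interior point the rate coincides near `θ₀` with its smooth extension. -/
lemma RegularAt.hasGradientAt_rate (hreg : RegularAt Θ p γ θ₀) (r : Fin K) :
    HasGradientAt (rate p r) (gradRate p r θ₀) θ₀ := by
  obtain ⟨V, g, hV, hΘV, hg, hrate⟩ := hreg.rate_smooth r
  have hgd : DifferentiableAt ℝ g θ₀ :=
    (hg.contDiffAt (hV.mem_nhds (hΘV hreg.mem))).differentiableAt (by norm_num)
  have heq : rate p r =ᶠ[𝓝 θ₀] g := by
    filter_upwards [mem_interior_iff_mem_nhds.1 hreg.mem_interior] with θ hθ using hrate θ hθ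
  exact (hgd.congr_of_eventuallyEq heq).hasGradientAt

/-- Periodicity is known only on `Θ`, but this is a neighbourhood of `θ₀` and the gradient is local.
-/
lemma IsDEDModel.gradRate_mod (hmodel : IsDEDModel Θ K D p Φ γ P G Y)
    (hreg : RegularAt Θ p γ θ₀) (s : ℕ) : gradRate p s θ₀ = gradRate p (s % K) θ₀ := by
  have heq : rate p s =ᶠ[𝓝 θ₀] rate p (s % K) := by
    filter_upwards [mem_interior_iff_mem_nhds.1 hreg.mem_interior] with θ hθ
    rw [rate, rate, hmodel.p_mod hθ s]
  rw [gradRate, gradRate, gradient, gradient, heq.fderiv_eq]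

/-- Chain rule for `p = 1 - exp (-λ)`. -/
lemma IsDEDModel.hasFDerivAt_p (hmodel : IsDEDModel Θ K D p Φ γ P G Y)
    (hreg : RegularAt Θ p γ θ₀) (r : Fin K) :
    HasFDerivAt (fun θ => p θ r) ((1 - p θ₀ r) • innerSL ℝ (gradRate p r θ₀)) θ₀ := by
  have h1 := (hreg.hasGradientAt_rate r).hasFDerivAt
  have h2 := (h1.neg.exp).const_sub 1
  have hp : ∀ θ ∈ Θ, p θ r = 1 - Real.exp (-rate p r θ) := by
    intro θ hθ
    have := hmodel.p_mem_Ioo hreg hθ r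
    rw [rate, eventRate_toReal this.1.le this.2, neg_neg, Real.exp_log (sub_pos.2 this.2)]
    ring
  have heq : (fun θ => p θ r) =ᶠ[𝓝 θ₀] fun θ => 1 - Real.exp (-rate p r θ) := by
    filter_upwards [mem_interior_iff_mem_nhds.1 hreg.mem_interior] with θ hθ using hp θ hθ
  refine (h2.congr_of_eventuallyEq heq).congr_fderiv ?_
  ext v
  have : 1 - p θ₀ r = Real.exp (-rate p r θ₀) := by rw [hp θ₀ hreg.mem]; ring
  simp [this]

variable {h : ℕ → Param d} {C : ℝ}

lemma tendsto_localParam (hC : ∀ t, ‖h t‖ ≤ C) :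
    Tendsto (fun t => localParam θ₀ (h t) t) atTop (𝓝 θ₀) := by
  have : Tendsto (fun t : ℕ => (1 / √(t : ℝ)) • h t) atTop (𝓝 0) := by
    refine tendsto_of_isBigO_inv_sqrt (C := C) (Eventually.of_forall fun t => ?_)
    rw [norm_smul, Real.norm_eq_abs, abs_of_nonneg (by positivity), one_div_mul_eq_div]
    exact div_le_div_of_nonneg_right (hC t) (Real.sqrt_nonneg _)
  simpa [localParam] using this.const_add θ₀

lemma RegularAt.eventually_localParam_mem (hreg : RegularAt Θ p γ θ₀) (hC : ∀ t, ‖h t‖ ≤ C) :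
    ∀ᶠ t in atTop, localParam θ₀ (h t) t ∈ Θ :=
  (tendsto_localParam hC).eventually (mem_interior_iff_mem_nhds.1 hreg.mem_interior)

/-- Differentiability at `θ₀` along increments that are `O(1 / √t)`; the linear part is kept because
`h t` need not converge. -/
lemma IsDEDModel.tendsto_sqrt_mul_p_sub (hmodel : IsDEDModel Θ K D p Φ γ P G Y)
    (hreg : RegularAt Θ p γ θ₀) (hC : ∀ t, ‖h t‖ ≤ C) (r : Fin K) :
    Tendsto (fun t : ℕ => √t * (p (localParam θ₀ (h t) t) r - p θ₀ r) -
      (1 - p θ₀ r) * inner ℝ (gradRate p r θ₀) (h t)) atTop (𝓝 0) := by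
  have hlo := (hmodel.hasFDerivAt_p hreg r).isLittleO.comp_tendsto
    (tendsto_localParam (θ₀ := θ₀) hC)
  have hbig : (fun t : ℕ => localParam θ₀ (h t) t - θ₀) =O[atTop] fun t : ℕ => (√(t : ℝ))⁻¹ := by
    refine Asymptotics.IsBigO.of_bound C (Eventually.of_forall fun t => ?_)
    rw [localParam, add_sub_cancel_left, norm_smul, one_div, mul_comm]
    exact mul_le_mul_of_nonneg_right (hC t) (norm_nonneg _)
  have hlo' := hlo.trans_isBigO hbig
  refine hlo'.tendsto_div_nhds_zero.congr' ?_
  filter_upwards [eventually_gt_atTop 0] with t ht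
  have hs : √(t : ℝ) ≠ 0 := (Real.sqrt_pos.2 (by exact_mod_cast ht)).ne'
  simp only [Function.comp_apply]
  rw [localParam, add_sub_cancel_left, div_inv_eq_mul, sub_mul, map_smul]
  simp only [smul_apply, innerSL_apply_apply, smul_eq_mul]
  field_simp

/-- Shifts of the event probabilities are `O(1 / √t)` over the finitely many phases. The
denominators are at least `a * b` uniformly on `Θ`, hence the bound in both directions. -/
lemma IsDEDModel.exists_sq_div_le (hmodel : IsDEDModel Θ K D p Φ γ P G Y)
    (hreg : RegularAt Θ p γ θ₀) (hC : ∀ t, ‖h t‖ ≤ C) :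
    ∃ M : ℝ, 0 ≤ M ∧ ∀ᶠ t : ℕ in atTop, ∀ s,
      (p (localParam θ₀ (h t) t) s - p θ₀ s) ^ 2 / (p θ₀ s * (1 - p θ₀ s)) ≤ M / t ∧
      (p θ₀ s - p (localParam θ₀ (h t) t) s) ^ 2 /
        (p (localParam θ₀ (h t) t) s * (1 - p (localParam θ₀ (h t) t) s)) ≤ M / t := by
  obtain ⟨a, b, ha, hb, hab⟩ := hmodel.exists_bounds hreg
  set B : ℝ := ∑ r : Fin K, ‖(1 - p θ₀ r) • gradRate p r θ₀‖ * C with hBdef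
  have hC0 : 0 ≤ C := (norm_nonneg _).trans (hC 0)
  have hcb : ∀ (r : Fin K) t, |(1 - p θ₀ r) * inner ℝ (gradRate p r θ₀) (h t)| ≤ B := by
    intro r t
    rw [← real_inner_smul_left]
    refine (abs_real_inner_le_norm _ _).trans ?_
    refine (mul_le_mul_of_nonneg_left (hC t) (norm_nonneg _)).trans ?_
    exact Finset.single_le_sum (f := fun r : Fin K => ‖(1 - p θ₀ r) • gradRate p r θ₀‖ * C)
      (fun r _ => by positivity) (Finset.mem_univ r)
  refine ⟨(B + 1) ^ 2 / (a * b), by positivity, ?_⟩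
  have hev : ∀ᶠ t : ℕ in atTop, ∀ r : Fin K,
      |√t * (p (localParam θ₀ (h t) t) r - p θ₀ r)| ≤ B + 1 :=
    eventually_all.2 fun r =>
      eventually_abs_sqrt_mul_le (hcb r) (hmodel.tendsto_sqrt_mul_p_sub hreg hC r)
  filter_upwards [hev, hreg.eventually_localParam_mem hC, eventually_gt_atTop 0] with t ht hθ ht0 s
  have ht0' : (0 : ℝ) < t := by exact_mod_cast ht0
  have hsq : (p (localParam θ₀ (h t) t) s - p θ₀ s) ^ 2 ≤ (B + 1) ^ 2 / t := by
    rw [hmodel.p_mod hθ s, hmodel.p_mod hreg.mem s, le_div_iff₀ ht0']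
    have h1 := pow_le_pow_left₀ (abs_nonneg _) (ht ⟨s % K, Nat.mod_lt s hmodel.period_pos⟩) 2
    rw [sq_abs, mul_pow, Real.sq_sqrt ht0'.le] at h1
    linarith
  have hgen : ∀ θ ∈ Θ, (p (localParam θ₀ (h t) t) s - p θ₀ s) ^ 2 / (p θ s * (1 - p θ s)) ≤
      (B + 1) ^ 2 / (a * b) / t := by
    intro θ hθ'
    have := hab θ hθ' s
    rw [div_right_comm]
    gcongr
    · linarith
    · exact this.1
    · exact this.2
  refine ⟨hgen θ₀ hreg.mem, ?_⟩
  rw [sub_sq_comm]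
  exact hgen _ hθ

lemma dotProduct_infoRate_mulVec (α : Fin K → ℝ) (u : Param d) :
    u.ofLp ⬝ᵥ (infoRate p θ₀ α *ᵥ u.ofLp) = (1 / (K : ℝ)) * ∑ r : Fin K, α r *
      ((1 - p θ₀ r) / p θ₀ r * (inner ℝ (gradRate p r θ₀) u) ^ 2) := by
  rw [infoRate, Matrix.smul_mulVec, dotProduct_smul, smul_eq_mul, Matrix.sum_mulVec,
    dotProduct_sum]
  congr 1
  refine Finset.sum_congr rfl fun r _ => ?_
  have hin : inner ℝ (gradRate p r θ₀) u = (gradRate p r θ₀).ofLp ⬝ᵥ u.ofLp := by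
    rw [EuclideanSpace.inner_eq_star_dotProduct, star_trivial, dotProduct_comm]
  rw [phaseInfo, Matrix.smul_mulVec, Matrix.smul_mulVec, Matrix.vecMulVec_mulVec, dotProduct_smul,
    dotProduct_smul, hin]
  simp only [op_smul_eq_smul, smul_eq_mul, dotProduct_comm u.ofLp, smul_dotProduct]
  ring

/-- Projects the vector score to the scalar sums treated in the expansion and in the central limit
theorem. -/
lemma inner_score (u : Param d) (t : ℕ) (x : Fin t → Bool × Bool) :
    inner ℝ (score p θ₀ t x) u =
      ∑ s : Fin t, rateScore (p θ₀ s) (x s) * (inner ℝ (gradRate p s θ₀) u / √t) := by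
  rw [score, real_inner_smul_left, sum_inner, Finset.mul_sum]
  refine Finset.sum_congr rfl fun s _ => ?_
  rw [real_inner_smul_left, rateScore]
  ring

/-- The second moment of the likelihood ratio is at most `(1 + M / t) ^ t ≤ exp M`. Both sequences
may vary with `t`, so the local alternative can play either role. -/
lemma contiguous_of_sq_div_le {Ω₁ : ℕ → Type*} [∀ t, MeasurableSpace (Ω₁ t)]
    {Ω₂ : ℕ → Type*} [∀ t, MeasurableSpace (Ω₂ t)] {μ₁ : (t : ℕ) → Measure (Ω₁ t)}
    [∀ t, IsProbabilityMeasure (μ₁ t)] {μ₂ : (t : ℕ) → Measure (Ω₂ t)}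
    [∀ t, IsProbabilityMeasure (μ₂ t)] {q₁ q₂ : ℕ → ℕ → ℝ} {γ₁ γ₂ : ℕ → Fin K → ℝ}
    {G₁ Y₁ : (t : ℕ) → ℕ → Ω₁ t → Bool} {G₂ Y₂ : (t : ℕ) → ℕ → Ω₂ t → Bool}
    (hΦ : ∀ t, Measurable (Function.uncurry (Φ t))) {M : ℝ} (hM : 0 ≤ M)
    (h : ∀ᶠ t : ℕ in atTop, IsDEDProcess (μ₁ t) K D (q₁ t) Φ (γ₁ t) (G₁ t) (Y₁ t) ∧
      IsDEDProcess (μ₂ t) K D (q₂ t) Φ (γ₂ t) (G₂ t) (Y₂ t) ∧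
      (∀ s, q₁ t s ∈ Set.Ioo (0 : ℝ) 1) ∧ (∀ s, q₂ t s ∈ Set.Ioo (0 : ℝ) 1) ∧
      ∀ s, (q₂ t s - q₁ t s) ^ 2 / (q₁ t s * (1 - q₁ t s)) ≤ M / t) :
    Contiguous (fun t => obsLaw (μ₂ t) (G₂ t) (Y₂ t) t)
      (fun t => obsLaw (μ₁ t) (G₁ t) (Y₁ t) t) := by
  have : ∀ t, IsFiniteMeasure (obsLaw (μ₁ t) (G₁ t) (Y₁ t) t) := fun t => by
    unfold obsLaw; infer_instance
  have : ∀ t, IsFiniteMeasure (obsLaw (μ₂ t) (G₂ t) (Y₂ t) t) := fun t => by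
    unfold obsLaw; infer_instance
  refine Contiguous.of_sq_le (Real.exp M) ?_
  filter_upwards [h, eventually_gt_atTop 0] with t ⟨h₁, h₂, hq₁, hq₂, hq⟩ ht A
  have ht0 : (0 : ℝ) < t := by exact_mod_cast ht
  refine (obsLaw_real_sq_le h₁ h₂ hΦ hq₁ hq₂ (by positivity) hq t A).trans ?_
  refine mul_le_mul_of_nonneg_right ?_ measureReal_nonneg
  calc (1 + M / t) ^ t ≤ Real.exp (M / t) ^ t := by
        gcongr
        linarith [Real.add_one_le_exp (M / t)]
    _ = Real.exp M := by
        rw [← Real.exp_nat_mul, mul_div_cancel₀ _ ht0.ne']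

end Model

end DED

namespace DED

/-! ### Asymptotic normality of the likelihood ratio and of the score. -/

section Model

variable {d K D : ℕ} {Θ : Set (Param d)} {p : Param d → ℕ → ℝ}
  {Φ : (t : ℕ) → (Fin t → Bool × Bool) → unitInterval → Bool} {γ : Param d → Fin K → ℝ}
  {Ω : Param d → Type*} [∀ θ, MeasurableSpace (Ω θ)] {P : (θ : Param d) → Measure (Ω θ)}
  [∀ θ, IsProbabilityMeasure (P θ)] {G Y : (θ : Param d) → ℕ → Ω θ → Bool} {θ₀ : Param d}

lemma le_sum_phases (hK : 0 < K) {f : ℕ → ℝ} (hf : ∀ s, 0 ≤ f s) (s : ℕ) :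
    f (s % K) ≤ ∑ r : Fin K, f r :=
  Finset.single_le_sum (f := fun r : Fin K => f r) (fun r _ => hf r)
    (Finset.mem_univ (⟨s % K, Nat.mod_lt s hK⟩ : Fin K))

/-- Local asymptotic normality of the model. -/
theorem IsDEDModel.isLittleOInProb_llr (hmodel : IsDEDModel Θ K D p Φ γ P G Y)
    (hreg : RegularAt Θ p γ θ₀) {h : ℕ → Param d} {C : ℝ} (hC : ∀ t, ‖h t‖ ≤ C) :
    IsLittleOInProb (fun t => obsLaw (P θ₀) (G θ₀) (Y θ₀) t) (fun t x =>
      llr (obsLaw (P (localParam θ₀ (h t) t)) (G _) (Y _) t)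
          (obsLaw (P θ₀) (G θ₀) (Y θ₀) t) x
        - (inner ℝ (h t) (score p θ₀ t x)
          - 1 / 2 * ((h t).ofLp ⬝ᵥ (infoRate p θ₀ (γ θ₀) *ᵥ (h t).ofLp)))) := by
  have hK := hmodel.period_pos
  have hproc := hmodel.isDEDProcess θ₀ hreg.mem
  have hmem := hreg.eventually_localParam_mem hC
  have hp₀ : ∀ s, p θ₀ s ∈ Set.Ioo (0 : ℝ) 1 := fun s => hmodel.p_mem_Ioo hreg hreg.mem s
  have hC0 : 0 ≤ C := (norm_nonneg _).trans (hC 0)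
  have hbound : ∀ t s, |inner ℝ (gradRate p s θ₀) (h t)| ≤ ∑ r : Fin K, ‖gradRate p r θ₀‖ * C := by
    intro t s
    rw [hmodel.gradRate_mod hreg s]
    refine (abs_real_inner_le_norm _ _).trans ?_
    refine (mul_le_mul_of_nonneg_left (hC t) (norm_nonneg _)).trans ?_
    exact le_sum_phases hK (f := fun r => ‖gradRate p r θ₀‖ * C)
      (fun r => mul_nonneg (norm_nonneg _) hC0) s
  have hexp := hproc.isLittleOInProb_logRatio hK hmodel.measurable_gating hp₀
    (hmodel.p_mod hreg.mem) (q' := fun t s => p (localParam θ₀ (h t) t) s)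
    (c := fun t s => inner ℝ (gradRate p s θ₀) (h t))
    (hmem.mono fun t ht s => hmodel.p_mod ht s)
    (fun t s => congrArg (fun v => inner ℝ v (h t)) (hmodel.gradRate_mod hreg s)) hbound
    (hmodel.tendsto_sqrt_mul_p_sub hreg hC)
  refine hexp.congr ?_
  filter_upwards [hmem] with t ht
  filter_upwards [llr_obsLaw hproc (hmodel.isDEDProcess _ ht) hmodel.measurable_gating hp₀
    (fun s => hmodel.p_mem_Ioo hreg ht s) t] with x hx
  rw [hx, real_inner_comm (score p θ₀ t x) (h t), inner_score, dotProduct_infoRate_mulVec]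

/-- Asymptotic normality of the score. -/
theorem IsDEDModel.tendstoInDistribution_score (hmodel : IsDEDModel Θ K D p Φ γ P G Y)
    (hreg : RegularAt Θ p γ θ₀) :
    TendstoInDistribution (fun t ω => score p θ₀ t (obs (G θ₀) (Y θ₀) t ω)) atTop
      (id : Param d → Param d) (fun _ => P θ₀)
      (multivariateGaussian 0 (infoRate p θ₀ (γ θ₀))) := by
  have hproc := hmodel.isDEDProcess θ₀ hreg.mem
  have hmeas : ∀ t, Measurable fun ω => score p θ₀ t (obs (G θ₀) (Y θ₀) t ω) :=
    fun t => (measurable_of_countable (score p θ₀ t)).comp (hproc.measurable_obs t)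
  refine ⟨fun t => (hmeas t).aemeasurable, aemeasurable_id, ?_⟩
  -- Lévy's theorem reduces the vector limit to one direction `u` at a time, with scalar
  -- coefficients `⟨∇λ_s, u⟩`.
  refine ProbabilityMeasure.tendsto_of_tendsto_charFun fun u => ?_
  simp only [ProbabilityMeasure.coe_mk, Measure.map_id]
  rw [charFun_multivariateGaussian hreg.info_posDef.posSemidef]
  have hlim := hproc.tendsto_integral_cexp_score hmodel.period_pos
    hmodel.measurable_gating (fun s => hmodel.p_mem_Ioo hreg hreg.mem s) (hmodel.p_mod hreg.mem)
    (c := fun s => inner ℝ (gradRate p s θ₀) u)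
    (fun s => congrArg (fun v => inner ℝ v u) (hmodel.gradRate_mod hreg s))
  rw [← dotProduct_infoRate_mulVec] at hlim
  refine (hlim.congr fun t => ?_).trans (le_of_eq ?_)
  · rw [charFun_apply, integral_map (hmeas t).aemeasurable (by fun_prop), obsLaw,
      integral_map (hproc.measurable_obs t).aemeasurable
        (StronglyMeasurable.of_discrete).aestronglyMeasurable]
    simp only [inner_score]
  · rw [inner_zero_right]
    congr 2
    push_cast
    ring

end Model

end DED

theorem proposition2 {d K : ℕ} (D : ℕ) (Θ : Set (DED.Param d)) (p : DED.Param d → ℕ → ℝ)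
    (Φ : (t : ℕ) → (Fin t → Bool × Bool) → unitInterval → Bool)
    (γ : DED.Param d → Fin K → ℝ)
    {Ω : DED.Param d → Type*} [∀ θ, MeasurableSpace (Ω θ)]
    (P : (θ : DED.Param d) → Measure (Ω θ)) [∀ θ, IsProbabilityMeasure (P θ)]
    (G Y : (θ : DED.Param d) → ℕ → Ω θ → Bool)
    (hmodel : DED.IsDEDModel Θ K D p Φ γ P G Y)
    (θ₀ : DED.Param d) (hreg : DED.RegularAt Θ p γ θ₀) :
    (∀ h : ℕ → DED.Param d, (∃ C : ℝ, ∀ t, ‖h t‖ ≤ C) →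
      -- the local alternatives are eventually in the model and the likelihood ratio is well defined
      (∀ᶠ t : ℕ in atTop, DED.localParam θ₀ (h t) t ∈ Θ ∧
        DED.obsLaw (P (DED.localParam θ₀ (h t) t)) (G _) (Y _) t ≪
          DED.obsLaw (P θ₀) (G θ₀) (Y θ₀) t ∧
        DED.obsLaw (P θ₀) (G θ₀) (Y θ₀) t ≪
          DED.obsLaw (P (DED.localParam θ₀ (h t) t)) (G _) (Y _) t) ∧
      -- mutual contiguity
      DED.Contiguous
        (fun t => DED.obsLaw (P (DED.localParam θ₀ (h t) t)) (G _) (Y _) t)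
        (fun t => DED.obsLaw (P θ₀) (G θ₀) (Y θ₀) t) ∧
      DED.Contiguous
        (fun t => DED.obsLaw (P θ₀) (G θ₀) (Y θ₀) t)
        (fun t => DED.obsLaw (P (DED.localParam θ₀ (h t) t)) (G _) (Y _) t) ∧
      -- the expansion of the log-likelihood ratio
      DED.IsLittleOInProb (fun t => DED.obsLaw (P θ₀) (G θ₀) (Y θ₀) t)
        (fun t x =>
          llr (DED.obsLaw (P (DED.localParam θ₀ (h t) t)) (G _) (Y _) t)
              (DED.obsLaw (P θ₀) (G θ₀) (Y θ₀) t) x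
            - (inner ℝ (h t) (DED.score p θ₀ t x)
              - 1 / 2 * ((h t).ofLp ⬝ᵥ (DED.infoRate p θ₀ (γ θ₀) *ᵥ (h t).ofLp))))) ∧
    -- asymptotic normality of the score
    TendstoInDistribution (fun t ω => DED.score p θ₀ t (DED.obs (G θ₀) (Y θ₀) t ω)) atTop
      (id : DED.Param d → DED.Param d) (fun _ => P θ₀)
      (multivariateGaussian 0 (DED.infoRate p θ₀ (γ θ₀))) := by
  have hΦ := hmodel.measurable_gating
  have hK := hmodel.period_pos
  have hθ₀ := hreg.mem
  have hproc := hmodel.isDEDProcess θ₀ hθ₀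
  have hp₀ : ∀ s, p θ₀ s ∈ Set.Ioo (0 : ℝ) 1 := fun s => hmodel.p_mem_Ioo hreg hθ₀ s
  refine ⟨?_, ?_⟩
  · rintro h ⟨C, hC⟩
    have hmem := hreg.eventually_localParam_mem hC
    obtain ⟨M, hM, hsq⟩ := hmodel.exists_sq_div_le hreg hC
    refine ⟨?_, ?_, ?_, ?_⟩
    · filter_upwards [hmem] with t ht
      have hp : ∀ s, p (DED.localParam θ₀ (h t) t) s ∈ Set.Ioo (0 : ℝ) 1 :=
        fun s => hmodel.p_mem_Ioo hreg ht s
      have hproc' := hmodel.isDEDProcess _ ht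
      exact ⟨ht, DED.obsLaw_absolutelyContinuous hproc hproc' hΦ hp₀ hp t,
        DED.obsLaw_absolutelyContinuous hproc' hproc hΦ hp hp₀ t⟩
    · refine DED.contiguous_of_sq_div_le (K := K) (D := D) (μ₁ := fun _ => P θ₀)
        (μ₂ := fun t => P (DED.localParam θ₀ (h t) t)) (q₁ := fun _ => p θ₀)
        (q₂ := fun t => p (DED.localParam θ₀ (h t) t)) (γ₁ := fun _ => γ θ₀)
        (γ₂ := fun t => γ (DED.localParam θ₀ (h t) t)) hΦ hM ?_
      filter_upwards [hmem, hsq] with t ht hs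
      exact ⟨hproc, hmodel.isDEDProcess _ ht, hp₀, fun s => hmodel.p_mem_Ioo hreg ht s,
        fun s => (hs s).1⟩
    · refine DED.contiguous_of_sq_div_le (K := K) (D := D) (μ₂ := fun _ => P θ₀)
        (μ₁ := fun t => P (DED.localParam θ₀ (h t) t)) (q₂ := fun _ => p θ₀)
        (q₁ := fun t => p (DED.localParam θ₀ (h t) t)) (γ₂ := fun _ => γ θ₀)
        (γ₁ := fun t => γ (DED.localParam θ₀ (h t) t)) hΦ hM ?_
      filter_upwards [hmem, hsq] with t ht hs
      exact ⟨hmodel.isDEDProcess _ ht, hproc, fun s => hmodel.p_mem_Ioo hreg ht s, hp₀,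
        fun s => (hs s).2⟩
    · exact hmodel.isLittleOInProb_llr hreg hC
  · exact hmodel.tendstoInDistribution_score hreg
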